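/- **Conventions.** Quasi-orders are reflexive transitive relations; equivalence means $x\le y\le x$, and a quasi-order is a wqo if every infinite sequence $(x_i)$ in it has indices $i<j$ with $x_i\le x_j$. A *monoidal quasi-order* is a quasi-order with a monoid operation that is monotone in both arguments and satisfies $x\le xy$; it is a *monoidal wqo* if moreover its order is a wqo. A *front* is an infinite family $F$ of finite sets of natural numbers, none of which is a proper initial segment of another, such that every infinite subset of $\bigcup F$ has an initial segment in $F$, together with a strictly decreasing ordinal-valued rank function on the tree of proper initial segments of elements of $F$; its rank is the value at $\emptyset$. For non-empty $\sigma,\tau$ write $\sigma\triangleleft\tau$ if $\min\sigma<\min\tau$ and one of $\sigma\setminus\{\min\sigma\}$ and $\tau$ is an initial segment of the other. A quasi-order $P$ is a *$\zeta$-wqo* if it is well-founded and for every front $F$ of rank $<\zeta$ and every $f\colon F\to P$ there are $\sigma\triangleleft\tau$ in $F$ with $f(\sigma)\le f(\tau)$. For a quasi-order $Q$, consider hereditary sets with urelements from $Q$, quasi-ordered by $\lesssim$: on urelements it is $\le_Q$; if $x,y$ are not both urelements, replace an urelement by its singleton, and put $x\lesssim y$ iff $\forall x'\in x\,\exists y'\in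 y\; x'\lesssim y'$. Let $\dot I^*_\alpha(Q)$ consist of the elements of $Q$ and of all non-empty sets $x$ of rank $<\alpha$ that are upward directed for $\lesssim$ and all of whose elements lie in $\bigcup_{\beta<\alpha}\dot I^*_\beta(Q)$ (a set of urelements has rank $0$; urelements do not contribute to the rank). If $Q$ is a monoidal quasi-order, its product extends by $x\cdot y=\{x'y' : x'\in x,\ y'\in y\}$ when $x,y$ are not both urelements, again replacing an urelement by its singleton; each $\dot I^*_\alpha(Q)$ is then a monoidal quasi-order under $\lesssim$. Let $P^{<\omega}$ be the finite sequences over a quasi-order $P$ with the embeddability order and concatenation, $P$ being identified with the sequences of length one, so that $\dot I^*_\alpha(P)\subseteq\dot I^*_\alpha(P^{<\omega})$. Put $S_0(P)=\emptyset$, $S_\lambda(P)=\bigcup_{\beta<\lambda}S_\beta(P)$ for limit $\lambda$, and $$S_{\alpha+1}(P)=S_\alpha(P)\cup\{X^* : \emptyset\ne X\subseteq S_\alpha(P)\cup\dot I^*_\alpha(P)\text{ downward closed in } S_\alpha(P)\cup\dot I^*_\alpha(P)\},$$ where $X^*$ is the set of finite products of elements of $X$. For a quasi-order $L$, a downward-closed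 $L_n\subseteq L$ and $L_i=L\setminus L_n$, let $H(L,L_n,L_i)$ be the set of finite sequences over $L$ with concatenation and the *generalized Higman ordering*: $(p_0,\dots,p_{n-1})\le_H(q_0,\dots,q_{m-1})$ iff there is a weakly increasing $f\colon\{0,\dots,n-1\}\to\{0,\dots,m-1\}$ with $p_i\le q_{f(i)}$ for all $i<n$, such that $q_j\in L_i$ whenever $|f^{-1}(j)|>1$. **Statement.** Let $\alpha$ be an ordinal and let $P$ be an $(\alpha+1)$-wqo. Then $\dot I^*_\alpha(P^{<\omega})/{\sim}$, where $\sim$ is the equivalence of $\lesssim$, is a monoidal wqo; in $\dot I^*_\alpha(P)\cup S_\alpha(P)$, ordered by $\lesssim$, the subset $\dot I^*_\alpha(P)$ is downward closed with complement $S_\alpha(P)$; and $\dot I^*_\alpha(P^{<\omega})/{\sim}$ is isomorphic, as an ordered monoid, to $$H\bigl(\dot I^*_\alpha(P)\cup S_\alpha(P),\ \dot I^*_\alpha(P),\ S_\alpha(P)\bigr)/{\equiv_H},$$ where $\equiv_H$ is the equivalence of $\le_H$. -/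

import Mathlib

universe u v

/-! ## Monoidal quasi-orders and their quotients -/

/-- A monoidal quasi-order: a monoid with a quasi-order for which the product is weakly increasing
and monotone. -/
class IsMonoidalQo (M : Type u) [Monoid M] [Preorder M] : Prop where
  le_mul : ∀ x y : M, x ≤ x * y
  mul_le_mul : ∀ {x x' y y' : M}, x ≤ x' → y ≤ y' → x * y ≤ x' * y'

/-- A monoidal well-quasi-order. -/
class IsMonoidalWqo (M : Type u) [Monoid M] [Preorder M] : Prop extends
  IsMonoidalQo M, WellQuasiOrderedLE M

/-- The quotient of a quasi-order by the equivalence `x ≤ y ∧ y ≤ x`. -/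
abbrev QoQuot (M : Type u) [Preorder M] : Type u := Antisymmetrization M (· ≤ ·)

section QoQuot

variable {M : Type u} [Monoid M] [Preorder M] [IsMonoidalQo M]

/-- Multiplication of equivalence classes. -/
instance QoQuot.instMonoid : Monoid (QoQuot M) where
  mul := Quotient.map₂ (· * ·) fun _ _ hx _ _ hy =>
    ⟨IsMonoidalQo.mul_le_mul hx.1 hy.1, IsMonoidalQo.mul_le_mul hx.2 hy.2⟩
  one := toAntisymmetrization (· ≤ ·) 1
  mul_assoc := by
    rintro ⟨a⟩ ⟨b⟩ ⟨c⟩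
    exact congrArg (toAntisymmetrization (α := M) (· ≤ ·)) (mul_assoc a b c)
  one_mul := by
    rintro ⟨a⟩
    exact congrArg (toAntisymmetrization (α := M) (· ≤ ·)) (one_mul a)
  mul_one := by
    rintro ⟨a⟩
    exact congrArg (toAntisymmetrization (α := M) (· ≤ ·)) (mul_one a)

theorem QoQuot.mk_mul_mk (x y : M) :
    (toAntisymmetrization (· ≤ ·) x * toAntisymmetrization (· ≤ ·) y : QoQuot M) =
      toAntisymmetrization (· ≤ ·) (x * y) := rfl

instance QoQuot.instIsMonoidalQo : IsMonoidalQo (QoQuot M) where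
  le_mul := by
    rintro ⟨x⟩ ⟨y⟩
    exact (IsMonoidalQo.le_mul x y : x ≤ x * y)
  mul_le_mul := by
    rintro ⟨x⟩ ⟨x'⟩ ⟨y⟩ ⟨y'⟩ h h'
    exact (IsMonoidalQo.mul_le_mul (h : x ≤ x') (h' : y ≤ y') : x * y ≤ x' * y')

end QoQuot

/-! ## Fronts, arrays and `ζ`-well-quasi-orders -/

/-- `s` is an initial segment of the set of natural numbers `t`. -/
def IsInitSeg (s t : Set ℕ) : Prop :=
  s ⊆ t ∧ ∀ x ∈ s, ∀ y ∈ t, y < x → y ∈ s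

/-- A front: an infinite family `F` of finite sets of natural numbers that is an antichain with
respect to initial segments, such that every infinite subset of `⋃ F` has an initial segment in
`F`, together with a strictly decreasing function from the tree of proper initial segments of
elements of `F` to the ordinals (the values of `rk` outside that tree are irrelevant). -/
structure Front where
  carrier : Set (Finset ℕ)
  infinite : carrier.Infinite
  antichain : ∀ σ ∈ carrier, ∀ τ ∈ carrier, IsInitSeg σ τ → σ = τ
  exists_initSeg : ∀ X : Set ℕ, X.Infinite → X ⊆ (⋃ σ ∈ carrier, (σ : Set ℕ)) →
    ∃ σ ∈ carrier, IsInitSeg σ X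
  rk : Finset ℕ → Ordinal.{v}
  rk_lt : ∀ σ τ : Finset ℕ,
    (∃ ρ ∈ carrier, IsInitSeg σ ρ ∧ σ ≠ ρ) → (∃ ρ ∈ carrier, IsInitSeg τ ρ ∧ τ ≠ ρ) →
    IsInitSeg σ τ → σ ≠ τ → rk τ < rk σ

/-- The relation `σ ◁ τ` between non-empty finite sets of natural numbers: `min σ < min τ`, and
`σ` without its minimum is comparable with `τ` with respect to initial segments. -/
def FrontShift (σ τ : Finset ℕ) : Prop :=
  ∃ (hσ : σ.Nonempty) (hτ : τ.Nonempty), σ.min' hσ < τ.min' hτ ∧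
    (IsInitSeg (σ.erase (σ.min' hσ)) τ ∨ IsInitSeg τ (σ.erase (σ.min' hσ)))

/-- An array `f : F → P` is bad if `f σ ≰ f τ` whenever `σ ◁ τ`. -/
def IsBadArray {P : Type u} [LE P] (F : Front.{v}) (f : F.carrier → P) : Prop :=
  ∀ σ τ : F.carrier, FrontShift σ τ → ¬ f σ ≤ f τ

/-- `P` is a `ζ`-wqo: it is well-founded and there is no bad array of rank `< ζ` with values
in `P`, the rank of an array being the rank of the empty set in its front. -/
def IsOrdinalWqo (P : Type u) [Preorder P] (ζ : Ordinal.{v}) : Prop :=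
  WellFoundedLT P ∧ ∀ F : Front.{v}, F.rk ∅ < ζ → ∀ f : F.carrier → P, ¬ IsBadArray F f

/-! ## Hereditary sets over a type of urelements -/

/-- Codes of sets with urelements from `Q`. -/
inductive PreHSet (Q : Type u) : Type (u + 1)
  | ur (q : Q) : PreHSet Q
  | node (ι : Type u) (f : ι → PreHSet Q) : PreHSet Q

namespace PreHSet

variable {Q : Type u}

/-- Extensional equality of codes. -/
def Equiv : PreHSet Q → PreHSet Q → Prop
  | ur p, ur q => p = q
  | ur _, node _ _ => False
  | node _ _, ur _ => False
  | node _ f, node _ g => (∀ i, ∃ j, Equiv (f i) (g j)) ∧ ∀ j, ∃ i, Equiv (f i) (g j)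

theorem equiv_refl (x : PreHSet Q) : Equiv x x := by
  induction x with
  | ur q => exact rfl
  | node ι f ih => exact ⟨fun i => ⟨i, ih i⟩, fun i => ⟨i, ih i⟩⟩

theorem equiv_symm {x y : PreHSet Q} (h : Equiv x y) : Equiv y x := by
  induction x generalizing y with
  | ur q =>
    cases y with
    | ur p => exact Eq.symm h
    | node κ g => exact h
  | node ι f ih =>
    cases y with
    | ur p => exact h
    | node κ g =>
      exact ⟨fun j => (h.2 j).imp fun i hi => ih i hi, fun i => (h.1 i).imp fun j hj => ih i hj⟩

theorem equiv_trans {x y z : PreHSet Q} (h : Equiv x y) (h' : Equiv y z) : Equiv x z := by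
  induction x generalizing y z with
  | ur q =>
    cases y with
    | ur p =>
      cases z with
      | ur r => exact Eq.trans h h'
      | node κ g => exact h'
    | node κ g => exact h.elim
  | node ι f ih =>
    cases y with
    | ur p => exact h.elim
    | node κ g =>
      cases z with
      | ur r => exact h'.elim
      | node μ k =>
        refine ⟨fun i => ?_, fun l => ?_⟩
        · obtain ⟨j, hj⟩ := h.1 i
          obtain ⟨l, hl⟩ := h'.1 j
          exact ⟨l, ih i hj hl⟩
        · obtain ⟨j, hj⟩ := h'.2 l
          obtain ⟨i, hi⟩ := h.2 j
          exact ⟨i, ih i hi hj⟩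

instance setoid (Q : Type u) : Setoid (PreHSet Q) where
  r := Equiv
  iseqv := ⟨equiv_refl, equiv_symm, equiv_trans⟩

section Order

variable [Preorder Q]

/-- The order `≲` with an urelement on the left. -/
def UrLe (p : Q) : PreHSet Q → Prop
  | ur q => p ≤ q
  | node _ g => ∃ j, UrLe p (g j)

/-- The order `≲` on codes. -/
def Le : PreHSet Q → PreHSet Q → Prop
  | ur p, y => UrLe p y
  | node _ f, ur q => ∀ i, Le (f i) (ur q)
  | node _ f, node _ g => ∀ i, ∃ j, Le (f i) (g j)

theorem le_of_equiv {x y : PreHSet Q} (h : Equiv x y) : Le x y := by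
  induction x generalizing y with
  | ur q =>
    cases y with
    | ur p => exact le_of_eq h
    | node κ g => exact h.elim
  | node ι f ih =>
    cases y with
    | ur p => exact h.elim
    | node κ g => exact fun i => (h.1 i).imp fun j hj => ih i hj

theorem le_trans' {x y z : PreHSet Q} (h : Le x y) (h' : Le y z) : Le x z := by
  induction x generalizing y z with
  | ur p =>
    induction y generalizing z with
    | ur q =>
      induction z with
      | ur r => exact le_trans (α := Q) h h'
      | node μ k ihz => exact Exists.imp (fun l hl => ihz l hl) h'
    | node κ g ihy =>
      obtain ⟨j, hj⟩ := h
      cases z with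
      | ur r => exact ihy j hj (h' j)
      | node μ k =>
        obtain ⟨l, hl⟩ := h' j
        exact ⟨l, ihy j hj hl⟩
  | node ι f ih =>
    cases y with
    | ur q =>
      cases z with
      | ur r => exact fun i => ih i (h i) h'
      | node μ k =>
        obtain ⟨l, hl⟩ := h'
        exact fun i => ⟨l, ih i (h i) hl⟩
    | node κ g =>
      cases z with
      | ur r =>
        intro i
        obtain ⟨j, hj⟩ := h i
        exact ih i hj (h' j)
      | node μ k =>
        intro i
        obtain ⟨j, hj⟩ := h i
        obtain ⟨l, hl⟩ := h' j
        exact ⟨l, ih i hj hl⟩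

end Order

section Mul

variable [Mul Q]

/-- The product of an urelement and a code. -/
def urMul (p : Q) : PreHSet Q → PreHSet Q
  | ur q => ur (p * q)
  | node κ g => node κ fun j => urMul p (g j)

/-- The product of codes. -/
def mul : PreHSet Q → PreHSet Q → PreHSet Q
  | ur p, y => urMul p y
  | node ι f, ur q => node ι fun i => mul (f i) (ur q)
  | node ι f, node κ g => node (ι × κ) fun ij => mul (f ij.1) (g ij.2)

theorem mul_equiv {x x' y y' : PreHSet Q} (h : Equiv x x') (h' : Equiv y y') :
    Equiv (mul x y) (mul x' y') := by
  induction x generalizing x' y y' with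
  | ur p =>
    cases x' with
    | node _ _ => exact h.elim
    | ur p' =>
      induction y generalizing y' with
      | ur q =>
        cases y' with
        | node _ _ => exact h'.elim
        | ur q' => exact congrArg₂ (· * ·) h h'
      | node κ g ihy =>
        cases y' with
        | ur _ => exact h'.elim
        | node κ' g' =>
          exact ⟨fun j => (h'.1 j).imp fun j' hj => ihy j hj,
            fun j' => (h'.2 j').imp fun j hj => ihy j hj⟩
  | node ι f ih =>
    cases x' with
    | ur _ => exact h.elim
    | node ι' f' =>
      cases y with
      | ur q =>
        cases y' with
        | node _ _ => exact h'.elim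
        | ur q' =>
          exact ⟨fun i => (h.1 i).imp fun i' hi => ih i hi h',
            fun i' => (h.2 i').imp fun i hi => ih i hi h'⟩
      | node κ g =>
        cases y' with
        | ur _ => exact h'.elim
        | node κ' g' =>
          refine ⟨fun ⟨i, j⟩ => ?_, fun ⟨i', j'⟩ => ?_⟩
          · obtain ⟨i', hi⟩ := h.1 i
            obtain ⟨j', hj⟩ := h'.1 j
            exact ⟨(i', j'), ih i hi hj⟩
          · obtain ⟨i, hi⟩ := h.2 i'
            obtain ⟨j, hj⟩ := h'.2 j'
            exact ⟨(i, j), ih i hi hj⟩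

end Mul

end PreHSet

/-- The sets with urelements from `Q`, together with the urelements themselves. -/
def HSet (Q : Type u) : Type (u + 1) := Quotient (PreHSet.setoid Q)

namespace HSet

variable {Q : Type u}

/-- The set or urelement with a given code. -/
def mk (x : PreHSet Q) : HSet Q := Quotient.mk _ x

/-- A code of a given set or urelement. -/
noncomputable def out (x : HSet Q) : PreHSet Q := Quotient.out x

theorem mk_out (x : HSet Q) : mk (out x) = x := Quotient.out_eq x

/-- The urelement `q`. -/
def ur (q : Q) : HSet Q := mk (PreHSet.ur q)

/-- The set with the elements `f i`. -/
noncomputable def range {ι : Type u} (f : ι → HSet Q) : HSet Q :=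
  mk (PreHSet.node ι fun i => out (f i))

/-- `x` is a set, that is, not an urelement. -/
def IsSet : HSet Q → Prop :=
  Quotient.lift (fun x => match x with
    | PreHSet.ur _ => False
    | PreHSet.node _ _ => True) (by
    rintro (p | ⟨ι, f⟩) (q | ⟨κ, g⟩) h
    · rfl
    · exact h.elim
    · exact h.elim
    · rfl)

/-- The elements of `x` (none if `x` is an urelement). -/
def elements : HSet Q → Set (HSet Q) :=
  Quotient.lift (fun x => match x with
    | PreHSet.ur _ => ∅
    | PreHSet.node _ f => Set.range fun i => mk (f i)) (by
    rintro (p | ⟨ι, f⟩) (q | ⟨κ, g⟩) h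
    · rfl
    · exact h.elim
    · exact h.elim
    · apply Set.Subset.antisymm
      · rintro _ ⟨i, rfl⟩
        obtain ⟨j, hj⟩ := h.1 i
        exact ⟨j, (Quotient.sound hj).symm⟩
      · rintro _ ⟨j, rfl⟩
        obtain ⟨i, hi⟩ := h.2 j
        exact ⟨i, Quotient.sound hi⟩)

instance : Membership (HSet Q) (HSet Q) := ⟨fun x y => y ∈ elements x⟩

theorem range_eq_mk {ι : Type u} (f : ι → PreHSet Q) :
    range (fun i => mk (f i)) = mk (PreHSet.node ι f) :=
  Quotient.sound ⟨fun i => ⟨i, Quotient.exact (mk_out (mk (f i)))⟩,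
    fun i => ⟨i, Quotient.exact (mk_out (mk (f i)))⟩⟩

@[simp] theorem not_isSet_ur (q : Q) : ¬ (ur q).IsSet := id

@[simp] theorem notMem_ur (x : HSet Q) (q : Q) : x ∉ ur q := id

@[simp] theorem isSet_range {ι : Type u} (f : ι → HSet Q) : (range f).IsSet := trivial

@[simp] theorem mem_range {ι : Type u} {f : ι → HSet Q} {x : HSet Q} :
    x ∈ range f ↔ ∃ i, f i = x := by
  change x ∈ Set.range (fun i => mk (out (f i))) ↔ _
  simp only [mk_out]
  rfl

theorem ur_injective : Function.Injective (ur : Q → HSet Q) := fun _ _ h => Quotient.exact h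

/-- Every member of `HSet Q` is an urelement or a set given by a small family of elements. -/
theorem ur_or_range (x : HSet Q) :
    (∃ q, x = ur q) ∨ ∃ (ι : Type u) (f : ι → HSet Q), x = range f := by
  rcases x with ⟨q | ⟨ι, f⟩⟩
  · exact Or.inl ⟨q, rfl⟩
  · exact Or.inr ⟨ι, fun i => mk (f i), (range_eq_mk f).symm⟩

/-- Induction on sets with urelements. -/
@[elab_as_elim]
theorem induction {C : HSet Q → Prop} (x : HSet Q) (h_ur : ∀ q, C (ur q))
    (h_range : ∀ (ι : Type u) (f : ι → HSet Q), (∀ i, C (f i)) → C (range f)) : C x := by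
  rcases x with ⟨x⟩
  induction x with
  | ur q => exact h_ur q
  | node ι f ih =>
    have h := h_range ι (fun i => mk (f i)) ih
    rw [range_eq_mk] at h
    exact h

/-- Sets with the same elements are equal. -/
theorem ext {x y : HSet Q} (hx : x.IsSet) (hy : y.IsSet) (h : ∀ z, z ∈ x ↔ z ∈ y) : x = y := by
  rcases x with ⟨p | ⟨ι, f⟩⟩
  · exact hx.elim
  rcases y with ⟨q | ⟨κ, g⟩⟩
  · exact hy.elim
  refine Quotient.sound ⟨fun i => ?_, fun j => ?_⟩
  · obtain ⟨j, hj⟩ := (h (mk (f i))).1 ⟨i, rfl⟩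
    exact ⟨j, Quotient.exact hj.symm⟩
  · obtain ⟨i, hi⟩ := (h (mk (g j))).2 ⟨j, rfl⟩
    exact ⟨i, Quotient.exact hi⟩

section Order

variable [Preorder Q]

/-- The quasi-order `≲` on sets with urelements from a quasi-order; see `ur_le_ur`, `ur_le_range`,
`range_le_ur` and `range_le_range` for its recursion equations. -/
instance : Preorder (HSet Q) where
  le := Quotient.lift₂ PreHSet.Le fun _ _ _ _ h h' => propext
    ⟨fun H => PreHSet.le_trans' (PreHSet.le_of_equiv (PreHSet.equiv_symm h))
        (PreHSet.le_trans' H (PreHSet.le_of_equiv h')),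
      fun H => PreHSet.le_trans' (PreHSet.le_of_equiv h)
        (PreHSet.le_trans' H (PreHSet.le_of_equiv (PreHSet.equiv_symm h')))⟩
  le_refl := by
    rintro ⟨x⟩
    exact PreHSet.le_of_equiv (PreHSet.equiv_refl x)
  le_trans := by
    rintro ⟨x⟩ ⟨y⟩ ⟨z⟩ h h'
    exact PreHSet.le_trans' h h'

@[simp] theorem ur_le_ur {p q : Q} : ur p ≤ ur q ↔ p ≤ q := Iff.rfl

@[simp] theorem ur_le_range {p : Q} {κ : Type u} {g : κ → HSet Q} :
    ur p ≤ range g ↔ ∃ j, ur p ≤ g j := by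
  have h : ∀ j, ur p ≤ g j ↔ ur p ≤ mk (out (g j)) := fun j => by
    rw [mk_out]
  simp only [h]
  rfl

@[simp] theorem range_le_ur {ι : Type u} {f : ι → HSet Q} {q : Q} :
    range f ≤ ur q ↔ ∀ i, f i ≤ ur q := by
  have h : ∀ i, f i ≤ ur q ↔ mk (out (f i)) ≤ ur q := fun i => by
    rw [mk_out]
  simp only [h]
  rfl

@[simp] theorem range_le_range {ι κ : Type u} {f : ι → HSet Q} {g : κ → HSet Q} :
    range f ≤ range g ↔ ∀ i, ∃ j, f i ≤ g j := by
  have h : ∀ i j, f i ≤ g j ↔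
      mk (out (f i)) ≤ mk (out (g j)) := fun i j => by
    rw [mk_out, mk_out]
  simp only [h]
  rfl

end Order

section Mul

/-- The product on sets with urelements from a magma; see `ur_mul_ur`, `ur_mul_range`,
`range_mul_ur` and `range_mul_range` for its recursion equations. -/
instance [Mul Q] : Mul (HSet Q) where
  mul := Quotient.map₂ PreHSet.mul fun _ _ h _ _ h' => PreHSet.mul_equiv h h'

section Mul'

variable [Mul Q]

@[simp] theorem ur_mul_ur (p q : Q) : ur p * ur q = ur (p * q) := rfl

@[simp] theorem ur_mul_range (p : Q) {κ : Type u} (g : κ → HSet Q) :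
    ur p * range g = range fun j => ur p * g j := by
  have h : (fun j => ur p * g j) =
      fun j => mk (PreHSet.mul (PreHSet.ur p) (out (g j))) := by
    funext j
    conv_lhs => rw [← mk_out (g j)]
    rfl
  rw [h, range_eq_mk]
  rfl

@[simp] theorem range_mul_ur {ι : Type u} (f : ι → HSet Q) (q : Q) :
    range f * ur q = range fun i => f i * ur q := by
  have h : (fun i => f i * ur q) =
      fun i => mk (PreHSet.mul (out (f i)) (PreHSet.ur q)) := by
    funext i
    conv_lhs => rw [← mk_out (f i)]
    rfl
  rw [h, range_eq_mk]
  rfl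

@[simp] theorem range_mul_range {ι κ : Type u} (f : ι → HSet Q) (g : κ → HSet Q) :
    range f * range g = range fun ij : ι × κ => f ij.1 * g ij.2 := by
  have h : (fun ij : ι × κ => f ij.1 * g ij.2) =
      fun ij => mk (PreHSet.mul (out (f ij.1)) (out (g ij.2))) := by
    funext ij
    conv_lhs => rw [← mk_out (f ij.1), ← mk_out (g ij.2)]
    rfl
  rw [h, range_eq_mk]
  rfl

end Mul'

/-- With urelements from a monoid, the sets with urelements form a monoid. -/
instance [Monoid Q] : Monoid (HSet Q) where
  one := ur 1
  mul_assoc := by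
    intro x y z
    induction x using induction generalizing y z with
    | h_ur p =>
      induction y using induction generalizing z with
      | h_ur q =>
        induction z using induction with
        | h_ur r => simp [mul_assoc]
        | h_range μ k ih =>
          simp only [ur_mul_range, ur_mul_ur] at ih ⊢
          simp only [ih]
      | h_range κ g ih =>
        rcases ur_or_range z with ⟨r, rfl⟩ | ⟨μ, k, rfl⟩
        · simp [ih]
        · simp [ih]
    | h_range ι f ih =>
      rcases ur_or_range y with ⟨q, rfl⟩ | ⟨κ, g, rfl⟩ <;>
      rcases ur_or_range z with ⟨r, rfl⟩ | ⟨μ, k, rfl⟩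
      · simp [ih]
      · simp [ih]
      · simp [ih]
      · simp only [range_mul_range, ih]
        refine ext (isSet_range _) (isSet_range _) fun w => ?_
        simp only [mem_range, Prod.exists]
  one_mul := by
    intro x
    change ur 1 * x = x
    induction x using induction with
    | h_ur q => simp
    | h_range ι f ih => simp [ih]
  mul_one := by
    intro x
    change x * ur 1 = x
    induction x using induction with
    | h_ur q => simp
    | h_range ι f ih => simp [ih]

end Mul

section MonoidalQo

variable [Monoid Q] [Preorder Q] [IsMonoidalQo Q]

theorem mul_le_mul_right' {x x' : HSet Q} (y : HSet Q) (h : x ≤ x') : x * y ≤ x' * y := by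
  induction x using induction generalizing x' y with
  | h_ur p =>
    induction x' using induction generalizing y with
    | h_ur p' =>
      induction y using induction with
      | h_ur q => exact ur_le_ur.2 (IsMonoidalQo.mul_le_mul (ur_le_ur.1 h) le_rfl)
      | h_range κ g ihy =>
        simp only [ur_mul_range, range_le_range]
        exact fun j => ⟨j, ihy j⟩
    | h_range ι' f' ihx' =>
      obtain ⟨i, hi⟩ := ur_le_range.1 h
      rcases ur_or_range y with ⟨q, rfl⟩ | ⟨κ, g, rfl⟩
      · simp only [range_mul_ur, ur_mul_ur, ur_le_range]
        exact ⟨i, ihx' i (ur q) hi⟩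
      · simp only [ur_mul_range, range_mul_range, range_le_range]
        exact fun j => ⟨(i, j), ihx' i (g j) hi⟩
  | h_range ι f ih =>
    rcases ur_or_range x' with ⟨p', rfl⟩ | ⟨ι', f', rfl⟩ <;>
    rcases ur_or_range y with ⟨q, rfl⟩ | ⟨κ, g, rfl⟩
    · simp only [range_mul_ur, ur_mul_ur, range_le_ur] at h ⊢
      exact fun i => ih i (ur q) (h i)
    · simp only [range_le_ur, range_mul_range, ur_mul_range, range_le_range] at h ⊢
      exact fun ij => ⟨ij.2, ih ij.1 (g ij.2) (h ij.1)⟩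
    · simp only [range_mul_ur, range_le_range] at h ⊢
      exact fun i => (h i).imp fun j hj => ih i (ur q) hj
    · simp only [range_mul_range, range_le_range] at h ⊢
      intro ij
      obtain ⟨j, hj⟩ := h ij.1
      exact ⟨(j, ij.2), ih ij.1 (g ij.2) hj⟩

theorem mul_le_mul_left' (x : HSet Q) {y y' : HSet Q} (h : y ≤ y') : x * y ≤ x * y' := by
  induction y using induction generalizing y' x with
  | h_ur p =>
    induction y' using induction generalizing x with
    | h_ur p' =>
      induction x using induction with
      | h_ur q => exact ur_le_ur.2 (IsMonoidalQo.mul_le_mul le_rfl (ur_le_ur.1 h))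
      | h_range κ g ihx =>
        simp only [range_mul_ur, range_le_range]
        exact fun j => ⟨j, ihx j⟩
    | h_range ι' f' ihy' =>
      obtain ⟨i, hi⟩ := ur_le_range.1 h
      rcases ur_or_range x with ⟨q, rfl⟩ | ⟨κ, g, rfl⟩
      · simp only [ur_mul_range, ur_mul_ur, ur_le_range]
        exact ⟨i, ihy' i (ur q) hi⟩
      · simp only [range_mul_ur, range_mul_range, range_le_range]
        exact fun j => ⟨(j, i), ihy' i (g j) hi⟩
  | h_range ι f ih =>
    rcases ur_or_range y' with ⟨p', rfl⟩ | ⟨ι', f', rfl⟩ <;>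
    rcases ur_or_range x with ⟨q, rfl⟩ | ⟨κ, g, rfl⟩
    · simp only [ur_mul_range, ur_mul_ur, range_le_ur] at h ⊢
      exact fun i => ih i (ur q) (h i)
    · simp only [range_le_ur, range_mul_range, range_mul_ur, range_le_range] at h ⊢
      exact fun ij => ⟨ij.1, ih ij.2 (g ij.1) (h ij.2)⟩
    · simp only [ur_mul_range, range_le_range] at h ⊢
      exact fun i => (h i).imp fun j hj => ih i (ur q) hj
    · simp only [range_mul_range, range_le_range] at h ⊢
      intro ij
      obtain ⟨j, hj⟩ := h ij.2
      exact ⟨(ij.1, j), ih ij.2 (g ij.1) hj⟩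

end MonoidalQo

end HSet

/-! ## Iterated ideals -/

section IterIdeal

variable {Q : Type u}

/-- `IterIdeal A α x`: the element `x` belongs to the `α`-th stage of the iterated ideals over the
set `A` of urelements. The stage consists of the urelements in `A` and of the non-empty sets `x` of
rank `< α` that are upward-directed with respect to `≲` and all of whose elements belong to earlier
stages. (That one `β < α` serves all elements of `x` expresses that the rank of `x` is `< α`.) -/
inductive IterIdeal [Preorder Q] (A : Set Q) : Ordinal.{u} → HSet Q → Prop
  | ur {α : Ordinal.{u}} {q : Q} (hq : q ∈ A) : IterIdeal A α (HSet.ur q)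
  | set {α β : Ordinal.{u}} {x : HSet Q} (hβ : β < α) (hx : x.IsSet) (hne : ∃ y, y ∈ x)
      (hmem : ∀ y ∈ x, IterIdeal A β y) (hdir : ∀ y ∈ x, ∀ z ∈ x, ∃ w ∈ x, y ≤ w ∧ z ≤ w) :
      IterIdeal A α x

theorem IterIdeal.mono [Preorder Q] {A : Set Q} {α β : Ordinal.{u}} {x : HSet Q}
    (h : IterIdeal A α x) (hαβ : α ≤ β) : IterIdeal A β x := by
  cases h with
  | ur hq => exact .ur hq
  | set hβ hx hne hmem hdir => exact .set (hβ.trans_le hαβ) hx hne hmem hdir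

variable [Monoid Q] [Preorder Q] [IsMonoidalQo Q]

theorem IterIdeal.le_mul {α : Ordinal.{u}} {y : HSet Q} (hy : IterIdeal Set.univ α y)
    (x : HSet Q) : x ≤ x * y := by
  induction hy generalizing x with
  | @ur α q hq =>
    induction x using HSet.induction with
    | h_ur p => exact IsMonoidalQo.le_mul p q
    | h_range ι f ih =>
      simp only [HSet.range_mul_ur, HSet.range_le_range]
      exact fun i => ⟨i, ih i⟩
  | @set α β y hβ hy hne hmem hdir ih =>
    rcases HSet.ur_or_range y with ⟨q, rfl⟩ | ⟨κ, g, rfl⟩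
    · exact (HSet.not_isSet_ur q hy).elim
    obtain ⟨_, hz⟩ := hne
    obtain ⟨j, rfl⟩ := HSet.mem_range.1 hz
    rcases HSet.ur_or_range x with ⟨p, rfl⟩ | ⟨ι, f, rfl⟩
    · simp only [HSet.ur_mul_range, HSet.ur_le_range]
      exact ⟨j, ih _ hz _⟩
    · simp only [HSet.range_mul_range, HSet.range_le_range]
      exact fun i => ⟨(i, j), ih _ hz _⟩

theorem IterIdeal.mul {α : Ordinal.{u}} {x y : HSet Q} (hx : IterIdeal Set.univ α x)
    (hy : IterIdeal Set.univ α y) : IterIdeal Set.univ α (x * y) := by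
  induction α using WellFoundedLT.induction generalizing x y with
  | ind α ih =>
    cases hx with
    | @ur _ p _ =>
      cases hy with
      | @ur _ q _ => exact .ur trivial
      | @set _ β _ hβ hy hne hmem hdir =>
        rcases HSet.ur_or_range y with ⟨q, rfl⟩ | ⟨κ, g, rfl⟩
        · exact (HSet.not_isSet_ur q hy).elim
        simp only [HSet.mem_range, HSet.ur_mul_range, exists_exists_eq_and, forall_exists_index,
          forall_apply_eq_imp_iff] at hne hmem hdir ⊢
        obtain ⟨_, i₀, rfl⟩ := hne
        refine .set hβ (HSet.isSet_range _) ?_ ?_ ?_ <;>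
        simp only [HSet.mem_range, exists_exists_eq_and, forall_exists_index,
          forall_apply_eq_imp_iff]
        · exact ⟨_, i₀, rfl⟩
        · exact fun j => ih β hβ (.ur trivial) (hmem j)
        · intro i j
          obtain ⟨k, h1, h2⟩ := hdir i j
          exact ⟨k, HSet.mul_le_mul_left' _ h1, HSet.mul_le_mul_left' _ h2⟩
    | @set _ β _ hβ hx hne hmem hdir =>
      rcases HSet.ur_or_range x with ⟨q, rfl⟩ | ⟨ι, f, rfl⟩
      · exact (HSet.not_isSet_ur q hx).elim
      simp only [HSet.mem_range, exists_exists_eq_and, forall_exists_index,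
        forall_apply_eq_imp_iff] at hne hmem hdir
      obtain ⟨_, i₀, rfl⟩ := hne
      cases hy with
      | @ur _ q _ =>
        rw [HSet.range_mul_ur]
        refine .set hβ (HSet.isSet_range _) ?_ ?_ ?_ <;>
        simp only [HSet.mem_range, exists_exists_eq_and, forall_exists_index,
          forall_apply_eq_imp_iff]
        · exact ⟨_, i₀, rfl⟩
        · exact fun j => ih β hβ (hmem j) (.ur trivial)
        · intro i j
          obtain ⟨k, h1, h2⟩ := hdir i j
          exact ⟨k, HSet.mul_le_mul_right' _ h1, HSet.mul_le_mul_right' _ h2⟩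
      | @set _ γ _ hγ hy hne' hmem' hdir' =>
        rcases HSet.ur_or_range y with ⟨q, rfl⟩ | ⟨κ, g, rfl⟩
        · exact (HSet.not_isSet_ur q hy).elim
        simp only [HSet.mem_range, exists_exists_eq_and, forall_exists_index,
          forall_apply_eq_imp_iff] at hne' hmem' hdir'
        obtain ⟨_, j₀, rfl⟩ := hne'
        rw [HSet.range_mul_range]
        refine .set (max_lt hβ hγ) (HSet.isSet_range _) ?_ ?_ ?_ <;>
        simp only [HSet.mem_range, exists_exists_eq_and, forall_exists_index,
          forall_apply_eq_imp_iff]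
        · exact ⟨_, (i₀, j₀), rfl⟩
        · exact fun j => ih _ (max_lt hβ hγ) ((hmem j.1).mono (le_max_left _ _))
            ((hmem' j.2).mono (le_max_right _ _))
        · intro i j
          obtain ⟨k, h1, h2⟩ := hdir i.1 j.1
          obtain ⟨l, h3, h4⟩ := hdir' i.2 j.2
          exact ⟨(k, l), (HSet.mul_le_mul_right' _ h1).trans (HSet.mul_le_mul_left' _ h3),
            (HSet.mul_le_mul_right' _ h2).trans (HSet.mul_le_mul_left' _ h4)⟩

/-- The iterated ideals of stage `α` over a monoidal quasi-order `Q`, as a submonoid of the sets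
with urelements from `Q`; the order is the restriction of `≲`. -/
def iterIdealMonoid (Q : Type u) [Monoid Q] [Preorder Q] [IsMonoidalQo Q] (α : Ordinal.{u}) :
    Submonoid (HSet Q) where
  carrier := {x | IterIdeal Set.univ α x}
  mul_mem' := IterIdeal.mul
  one_mem' := IterIdeal.ur trivial

instance (α : Ordinal.{u}) : IsMonoidalQo (iterIdealMonoid Q α) where
  le_mul x y := IterIdeal.le_mul y.2 x.1
  mul_le_mul {_ x' y _} h h' := by
    exact (HSet.mul_le_mul_right' (y : HSet Q) (show (_ : HSet Q) ≤ x' from h)).trans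
      (HSet.mul_le_mul_left' (x' : HSet Q) h')

end IterIdeal

/-! ## Finite sequences -/

section Words

variable {P : Type u} [Preorder P]

/-- The embeddability order on finite sequences. The product of `FreeMonoid P` is concatenation. -/
instance FreeMonoid.instPreorderHigman : Preorder (FreeMonoid P) where
  le l l' := List.SublistForall₂ (· ≤ ·) l.toList l'.toList
  le_refl l := refl_of (List.SublistForall₂ (· ≤ ·)) l.toList
  le_trans _ _ _ h h' := trans_of (List.SublistForall₂ (· ≤ ·)) h h'

instance FreeMonoid.instIsMonoidalQoHigman : IsMonoidalQo (FreeMonoid P) where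
  le_mul x y := (List.sublist_append_left x.toList y.toList).sublistForall₂
  mul_le_mul {x x' y y'} h h' := by
    obtain ⟨l, hl, hl'⟩ := List.sublistForall₂_iff.1 h
    obtain ⟨m, hm, hm'⟩ := List.sublistForall₂_iff.1 h'
    exact List.sublistForall₂_iff.2 ⟨l ++ m, List.rel_append hl hm, hl'.append hm'⟩

end Words

/-- The `α`-th stage `I_α(P)` of the iterated ideals of `P`, as a set of iterated ideals of
`P^{<ω}`; an element of `P` is identified with the corresponding sequence of length one. -/
def letterIdeals (P : Type u) [Preorder P] (α : Ordinal.{u}) : Set (HSet (FreeMonoid P)) :=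
  {x | IterIdeal (Set.range FreeMonoid.of) α x}

/-- The non-empty downward-closed subsets of `B`, for a set `B` in a quasi-order. -/
def downSets {M : Type u} [Preorder M] (B : Set M) : Set (Set M) :=
  {X | X.Nonempty ∧ X ⊆ B ∧ ∀ x ∈ X, ∀ b ∈ B, b ≤ x → b ∈ X}

/-- The hierarchy `S_α(P)`: `S_0(P) = ∅`; `S_{α+1}(P)` consists of `S_α(P)` and of all sets `X^*`
with `X` a non-empty downward-closed subset of `S_α(P) ∪ I_α(P)`, where `X^*` is the set of finite
products of elements of `X`; and `S_λ(P)` is the union of the `S_β(P)`, `β < λ`, at limits `λ`. -/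
noncomputable def starIdeals (P : Type u) [Preorder P] (α : Ordinal.{u}) :
    Set (HSet (FreeMonoid P)) :=
  Ordinal.limitRecOn α ∅
    (fun β S => S ∪ {z | ∃ X ∈ downSets (S ∪ letterIdeals P β),
      z.IsSet ∧ ∀ w, w ∈ z ↔ w ∈ Submonoid.closure X})
    (fun l _ S => ⋃ (β : Ordinal.{u}) (hβ : β < l), S β hβ)

/-! ## Generalized Higman orderings -/

/-- The finite sequences over `L`, to be ordered by the generalized Higman ordering on
`L, Ln, Li`, where `Ln` is downward-closed in `L` and `Li` is its complement. -/
def GenHigman {L : Type u} [Preorder L] (Ln Li : Set L) (_ : IsLowerSet Ln) (_ : Li = Lnᶜ) :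
    Type u := FreeMonoid L

namespace GenHigman

variable {L : Type u} [Preorder L] {Ln Li : Set L}

/-- `u ≤ v` in the generalized Higman ordering: there is a weakly increasing map `f` from the
positions of `u` to the positions of `v` such that each letter of `u` is below its image and only
positions of `v` that carry a letter from `Li` have more than one preimage. -/
def Le (Li : Set L) (u v : List L) : Prop :=
  ∃ f : Fin u.length → Fin v.length, Monotone f ∧ (∀ i, u.get i ≤ v.get (f i)) ∧
    ∀ j, 1 < Nat.card {i // f i = j} → v.get j ∈ Li

theorem one_lt_card_fiber_iff {m n : ℕ} {f : Fin m → Fin n} {j : Fin n} :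
    1 < Nat.card {i // f i = j} ↔ ∃ i i', i ≠ i' ∧ f i = j ∧ f i' = j := by
  rw [Finite.one_lt_card_iff_nontrivial, nontrivial_iff]
  constructor
  · rintro ⟨⟨i, hi⟩, ⟨i', hi'⟩, h⟩
    exact ⟨i, i', fun e => h (Subtype.ext e), hi, hi'⟩
  · rintro ⟨i, i', h, hi, hi'⟩
    exact ⟨⟨i, hi⟩, ⟨i', hi'⟩, fun e => h (congrArg Subtype.val e)⟩

theorem le_iff {u v : List L} : Le Li u v ↔
    ∃ f : Fin u.length → Fin v.length, Monotone f ∧ (∀ i, u.get i ≤ v.get (f i)) ∧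
      ∀ i i', i ≠ i' → f i = f i' → v.get (f i) ∈ Li := by
  simp only [Le, one_lt_card_fiber_iff]
  refine exists_congr fun f => and_congr_right fun _ => and_congr_right fun _ => ?_
  constructor
  · exact fun h i i' hne he => h (f i) ⟨i, i', hne, rfl, he.symm⟩
  · rintro h _ ⟨i, i', hne, rfl, he⟩
    exact h i i' hne he.symm

theorem Le.refl (u : List L) : Le Li u u :=
  le_iff.2 ⟨id, monotone_id, fun _ => le_rfl, fun _ _ h h' => (h h').elim⟩

theorem Le.trans (hup : IsUpperSet Li) {u v w : List L} (h : Le Li u v) (h' : Le Li v w) :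
    Le Li u w := by
  obtain ⟨f, hf, hle, hf'⟩ := le_iff.1 h
  obtain ⟨g, hg, hle', hg'⟩ := le_iff.1 h'
  refine le_iff.2 ⟨g ∘ f, hg.comp hf, fun i => (hle i).trans (hle' (f i)), fun i i' hne he => ?_⟩
  by_cases hfe : f i = f i'
  · exact hup (hle' (f i)) (hf' i i' hne hfe)
  · exact hg' (f i) (f i') hfe he

theorem Le.append_right (u v : List L) : Le Li u (u ++ v) := by
  refine le_iff.2 ⟨fun i => ⟨i, by simp; omega⟩, fun i i' h => h, fun i => ?_, fun i i' hne he => ?_⟩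
  · simp [List.getElem_append_left]
  · exact (hne (Fin.ext (Fin.mk.inj_iff.1 he))).elim

theorem Le.append {u u' v v' : List L} (h : Le Li u u') (h' : Le Li v v') :
    Le Li (u ++ v) (u' ++ v') := by
  obtain ⟨f, hf, hle, hf'⟩ := le_iff.1 h
  obtain ⟨g, hg, hle', hg'⟩ := le_iff.1 h'
  have hlen : ∀ i : Fin (u ++ v).length, ¬ (i : ℕ) < u.length → (i : ℕ) - u.length < v.length := by
    intro i hi
    have h1 := i.2.trans_eq List.length_append
    omega
  let F : Fin (u ++ v).length → Fin (u' ++ v').length := fun i =>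
    if hi : (i : ℕ) < u.length then
      ⟨f ⟨i, hi⟩, by have := (f ⟨i, hi⟩).2; simp only [List.length_append]; omega⟩
    else ⟨u'.length + g ⟨i - u.length, hlen i hi⟩, by
      have := (g ⟨i - u.length, hlen i hi⟩).2; simp only [List.length_append]; omega⟩
  have F1 : ∀ (i : Fin (u ++ v).length) (hi : (i : ℕ) < u.length), (F i : ℕ) = f ⟨i, hi⟩ := fun i hi => by
    simp only [F, dif_pos hi]
  have F2 : ∀ (i : Fin (u ++ v).length) (hi : ¬ (i : ℕ) < u.length),
      (F i : ℕ) = u'.length + g ⟨i - u.length, hlen i hi⟩ := fun i hi => by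
    simp only [F, dif_neg hi]
  have G1 : ∀ (i : Fin (u ++ v).length) (hi : (i : ℕ) < u.length), (u' ++ v').get (F i) = u'.get (f ⟨i, hi⟩) := by
    intro i hi
    simp only [List.get_eq_getElem, F1 i hi]
    exact List.getElem_append_left _
  have G2 : ∀ (i : Fin (u ++ v).length) (hi : ¬ (i : ℕ) < u.length),
      (u' ++ v').get (F i) = v'.get (g ⟨i - u.length, hlen i hi⟩) := by
    intro i hi
    simp only [List.get_eq_getElem, F2 i hi]
    rw [List.getElem_append_right (by omega)]
    simp
  refine le_iff.2 ⟨F, fun i i' hii => ?_, fun i => ?_, fun i i' hne he => ?_⟩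
  · rw [Fin.le_def] at hii ⊢
    by_cases hi : (i : ℕ) < u.length
    · by_cases hi' : (i' : ℕ) < u.length
      · rw [F1 i hi, F1 i' hi']
        exact hf (Fin.mk_le_mk.2 hii)
      · rw [F1 i hi, F2 i' hi']
        have := (f ⟨i, hi⟩).2
        omega
    · have hi' : ¬ (i' : ℕ) < u.length := by omega
      rw [F2 i hi, F2 i' hi']
      have h1 : g ⟨i - u.length, hlen i hi⟩ ≤ g ⟨i' - u.length, hlen i' hi'⟩ :=
        hg (Fin.mk_le_mk.2 (by omega))
      rw [Fin.le_def] at h1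
      omega
  · by_cases hi : (i : ℕ) < u.length
    · rw [G1 i hi]
      refine le_of_eq_of_le ?_ (hle ⟨i, hi⟩)
      exact List.getElem_append_left _
    · rw [G2 i hi]
      refine le_of_eq_of_le ?_ (hle' ⟨i - u.length, hlen i hi⟩)
      exact List.getElem_append_right (by omega)
  · have he' : (F i : ℕ) = F i' := congrArg Fin.val he
    have hne' : (i : ℕ) ≠ i' := fun e => hne (Fin.ext e)
    by_cases hi : (i : ℕ) < u.length
    · by_cases hi' : (i' : ℕ) < u.length
      · rw [G1 i hi]
        rw [F1 i hi, F1 i' hi'] at he'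
        exact hf' _ ⟨i', hi'⟩ (fun e => hne' (Fin.mk.inj_iff.1 e)) (Fin.ext he')
      · rw [F1 i hi, F2 i' hi'] at he'
        have := (f ⟨i, hi⟩).2
        omega
    · by_cases hi' : (i' : ℕ) < u.length
      · rw [F2 i hi, F1 i' hi'] at he'
        have := (f ⟨i', hi'⟩).2
        omega
      · rw [G2 i hi]
        rw [F2 i hi, F2 i' hi'] at he'
        refine hg' _ ⟨i' - u.length, hlen i' hi'⟩ (fun e => hne' ?_) (Fin.ext (by omega))
        have h1 := Fin.mk.inj_iff.1 e
        omega

variable {hn : IsLowerSet Ln} {hi : Li = Lnᶜ}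

/-- The product is concatenation. -/
instance : Monoid (GenHigman Ln Li hn hi) := inferInstanceAs (Monoid (FreeMonoid L))

instance : Preorder (GenHigman Ln Li hn hi) where
  le u v := Le Li (FreeMonoid.toList u) (FreeMonoid.toList v)
  le_refl u := Le.refl _
  le_trans u v w := Le.trans (hi ▸ hn.compl)

instance : IsMonoidalQo (GenHigman Ln Li hn hi) where
  le_mul u v := Le.append_right (FreeMonoid.toList u) (FreeMonoid.toList v)
  mul_le_mul h h' := Le.append h h'

end GenHigman

/-- The letters: the elements of `I_α(P) ∪ S_α(P)`, with the order `≲`. -/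
abbrev Letters (P : Type u) [Preorder P] (α : Ordinal.{u}) : Type (u + 1) :=
  ↥(letterIdeals P α ∪ starIdeals P α)

/-! ## Elements of sets with urelements -/

namespace HSet

variable {Q : Type u}

/-! The isomorphism is induced by the product map from words of letters, i.e. of elements of
`letterSet P α`, to iterated ideals over the finite sequences. By `QoQuot.nonempty_orderMonoidIso`
it suffices that this map preserves and reflects the order and is surjective up to equivalence.

Order (`letterProd_le_of_rel`, `rel_of_letterProd_le`). A letter `y = X^*` satisfies `y * y ≤ y`, so
it can absorb several letters. A letter `y` that is an iterated ideal over `P` absorbs only one: if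
`x * c ≤ y * b` and `x ≰ 1`, then `c ≤ b`. And if `x * c ≤ y * b` with `x` a letter and `x ≰ y`,
then `x * c ≤ b`. So products are compared by looking at first letters, which is the recursion of
the generalized Higman ordering. The cancellation laws are evident for finite sequences and lift to
hereditary sets by simultaneous induction on four arguments.

Letters form a wqo (`wellQuasiOrdered_letters`). A failure of `x ≤ y` is witnessed by an element (or
generator) of `x` that is below none of those of `y`. Iterating this along a bad sequence and its
shifts leads down to elements of `P`. Each descent reads only a finite initial segment of the
sequence; these segments form a front of rank `α`, ranked by stages of the hierarchy, and the final
values would be a bad array in `P`. Higman's lemma passes from letters to words.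

Surjectivity (`exists_letterProd_equiv`). By induction, the elements of an iterated ideal `z` of
stage `α` are equivalent to words over letters of some stage `β < α`, and these words form a
directed set. Over a wqo of letters such a set is cofinal in a finite product of factors of two
kinds: words of length at most one over an ideal `J` of letters that are not stars, and all words
over a lower set `X` (`WordAtom.exists_cofinal`). The factors are realised by the letters `J` and
`X^*` of stage `α`. -/

theorem isSet_or_ur (x : HSet Q) : x.IsSet ∨ ∃ q, x = ur q := by
  rcases ur_or_range x with h | ⟨ι, f, rfl⟩
  · exact .inr h
  · exact .inl (isSet_range f)

/-- The elements of a set, and the urelement itself in the case of an urelement. -/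
def els (x : HSet Q) : Set (HSet Q) := {y | y ∈ x ∨ ¬ x.IsSet ∧ y = x}

@[simp] theorem els_ur (q : Q) : els (ur q) = {ur q} := by
  ext y
  simp [els]

@[simp] theorem els_range {ι : Type u} (f : ι → HSet Q) : els (range f) = Set.range f := by
  ext y
  simp [els]

theorem mem_els_of_isSet {x y : HSet Q} (hx : x.IsSet) : y ∈ els x ↔ y ∈ x := by
  simp [els, hx]

/-- Sets are indexed by types in `u`, whereas letters live in `u + 1`; hence the smallness condition
whenever a set of letters is to become a letter. -/
theorem exists_isSet_mem_iff (s : Set (HSet Q)) [Small.{u} s] :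
    ∃ z : HSet Q, z.IsSet ∧ ∀ w, w ∈ z ↔ w ∈ s := by
  refine ⟨range fun i : Shrink.{u} s => ((equivShrink s).symm i).1, isSet_range _, fun w => ?_⟩
  rw [mem_range]
  constructor
  · rintro ⟨i, rfl⟩
    exact Subtype.coe_prop _
  · exact fun hw => ⟨equivShrink s ⟨w, hw⟩, by simp⟩

/-- Replaces the four recursion equations by one. For two urelements it is vacuous, since an
urelement is its own only member of `els`; inductions along it need a separate base case. -/
theorem le_iff_els [Preorder Q] {x y : HSet Q} :
    x ≤ y ↔ ∀ x' ∈ els x, ∃ y' ∈ els y, x' ≤ y' := by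
  rcases ur_or_range x with ⟨p, rfl⟩ | ⟨ι, f, rfl⟩ <;>
  rcases ur_or_range y with ⟨q, rfl⟩ | ⟨κ, g, rfl⟩ <;> simp

theorem not_le_iff_els [Preorder Q] {x y : HSet Q} :
    ¬ x ≤ y ↔ ∃ x' ∈ els x, ∀ y' ∈ els y, ¬ x' ≤ y' := by
  rw [le_iff_els]
  push Not
  rfl

theorem els_mul [Mul Q] (x y : HSet Q) : els (x * y) = Set.image2 (· * ·) (els x) (els y) := by
  rcases ur_or_range x with ⟨p, rfl⟩ | ⟨ι, f, rfl⟩ <;>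
  rcases ur_or_range y with ⟨q, rfl⟩ | ⟨κ, g, rfl⟩
  · simp
  · ext z; simp
  · ext z; simp
  · ext z
    simp only [range_mul_range, els_range, Set.mem_range, Prod.exists, Set.mem_image2,
      exists_exists_eq_and]

theorem mul_mem_els [Mul Q] {x y x' y' : HSet Q} (hx : x' ∈ els x) (hy : y' ∈ els y) :
    x' * y' ∈ els (x * y) := by
  rw [els_mul]
  exact ⟨x', hx, y', hy, rfl⟩

@[simp] theorem els_one [Monoid Q] : els (1 : HSet Q) = {1} := els_ur 1

/-- Every element `y` of a set `x` satisfies `y ≤ x`. -/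
theorem le_of_mem_els [Preorder Q] {x y : HSet Q} (h : y ∈ els x) : y ≤ x := by
  induction x using induction generalizing y with
  | h_ur q => exact (Set.mem_singleton_iff.1 ((els_ur q) ▸ h)).le
  | h_range ι f ih =>
    rw [els_range] at h
    obtain ⟨i, rfl⟩ := h
    rw [le_iff_els]
    exact fun y hy => ⟨f i, by simp, ih i hy⟩

/-- `x` has rank at most `α`, the rank of a set of urelements being `1`. -/
inductive RankLE : Ordinal.{u} → HSet Q → Prop
  | ur {α : Ordinal.{u}} (q : Q) : RankLE α (ur q)
  | set {α β : Ordinal.{u}} {x : HSet Q} (hβ : β < α) (h : ∀ y ∈ els x, RankLE β y) : RankLE α x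

theorem RankLE.mono {α β : Ordinal.{u}} {x : HSet Q} (h : RankLE α x) (hαβ : α ≤ β) :
    RankLE β x := by
  cases h with
  | ur q => exact .ur q
  | set hβ h => exact .set (hβ.trans_le hαβ) h

theorem exists_rankLE (x : HSet Q) : ∃ α, RankLE α x := by
  induction x using induction with
  | h_ur q => exact ⟨0, .ur q⟩
  | h_range ι f ih =>
    choose α hα using ih
    refine ⟨_, .set (Order.lt_succ (⨆ i, α i)) fun y hy => ?_⟩
    rw [els_range] at hy
    obtain ⟨i, rfl⟩ := hy
    exact (hα i).mono (Ordinal.le_iSup α i)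

/-- The bound `β ≤ γ` allows several arguments to be treated in a row and to end with a common
bound. An urelement is its own element, so nothing but `β < α` provides a smaller stage for it. -/
theorem RankLE.exists_lt {α β : Ordinal.{u}} {x : HSet Q} (h : RankLE α x) (hβ : β < α) :
    ∃ γ < α, β ≤ γ ∧ ∀ y ∈ els x, RankLE γ y := by
  cases h with
  | ur q => exact ⟨β, hβ, le_rfl, by simpa using .ur q⟩
  | @set _ γ _ hγ h =>
    exact ⟨max β γ, max_lt hβ hγ, le_max_left _ _, fun y hy => (h y hy).mono (le_max_right _ _)⟩

/-- Simultaneous induction on four sets with urelements. -/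
theorem induction₄ {C : HSet Q → HSet Q → HSet Q → HSet Q → Prop}
    (h_ur : ∀ p q r s, C (ur p) (ur q) (ur r) (ur s))
    (h_els : ∀ x y a b, (∀ x' ∈ els x, ∀ y' ∈ els y, ∀ a' ∈ els a, ∀ b' ∈ els b, C x' y' a' b') →
      C x y a b) (x y a b : HSet Q) : C x y a b := by
  suffices H : ∀ α : Ordinal.{u}, ∀ x y a b : HSet Q, RankLE α x → RankLE α y → RankLE α a →
      RankLE α b → C x y a b by
    obtain ⟨α₁, h₁⟩ := exists_rankLE x
    obtain ⟨α₂, h₂⟩ := exists_rankLE y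
    obtain ⟨α₃, h₃⟩ := exists_rankLE a
    obtain ⟨α₄, h₄⟩ := exists_rankLE b
    refine H (max (max α₁ α₂) (max α₃ α₄)) x y a b (h₁.mono ?_) (h₂.mono ?_) (h₃.mono ?_)
      (h₄.mono ?_) <;> simp
  intro α
  induction α using WellFoundedLT.induction with
  | ind α ih =>
    intro x y a b hx hy ha hb
    -- If one of the four is a set, some `β < α` exists, and all four can be replaced by members of
    -- `els` of a common smaller rank; urelements simply stay in place.
    have key : ∀ β < α, C x y a b := by
      intro β hβ
      obtain ⟨γ₁, h₁, -, hx'⟩ := hx.exists_lt hβ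
      obtain ⟨γ₂, h₂, h₁₂, hy'⟩ := hy.exists_lt h₁
      obtain ⟨γ₃, h₃, h₂₃, ha'⟩ := ha.exists_lt h₂
      obtain ⟨γ₄, h₄, h₃₄, hb'⟩ := hb.exists_lt h₃
      exact h_els x y a b fun x' hx₁ y' hy₁ a' ha₁ b' hb₁ => ih γ₄ h₄ x' y' a' b'
        ((hx' x' hx₁).mono (h₁₂.trans (h₂₃.trans h₃₄))) ((hy' y' hy₁).mono (h₂₃.trans h₃₄))
        ((ha' a' ha₁).mono h₃₄) (hb' b' hb₁)
    cases hx with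
    | set hβ _ => exact key _ hβ
    | ur p =>
      cases hy with
      | set hβ _ => exact key _ hβ
      | ur q =>
        cases ha with
        | set hβ _ => exact key _ hβ
        | ur r =>
          cases hb with
          | set hβ _ => exact key _ hβ
          | ur s => exact h_ur p q r s

end HSet

/-! ## Elements of iterated ideals -/

namespace IterIdeal

variable {Q : Type u} [Preorder Q] {A B : Set Q} {α : Ordinal.{u}} {x y z : HSet Q}

theorem mono_set (h : IterIdeal A α x) (hAB : A ⊆ B) : IterIdeal B α x := by
  induction h with
  | ur hq => exact .ur (hAB hq)
  | set hβ hx hne _ hdir ih => exact .set hβ hx hne ih hdir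

theorem of_mem_els (h : IterIdeal A α x) (hy : y ∈ x.els) : IterIdeal A α y := by
  cases h with
  | ur hq =>
    rw [HSet.els_ur] at hy
    exact hy ▸ .ur hq
  | set hβ hx hne hmem hdir => exact (hmem y ((HSet.mem_els_of_isSet hx).1 hy)).mono hβ.le

theorem els_nonempty (h : IterIdeal A α x) : x.els.Nonempty := by
  cases h with
  | ur hq => simp
  | set hβ hx hne hmem hdir => exact hne.imp fun y hy => (HSet.mem_els_of_isSet hx).2 hy

theorem els_directed (h : IterIdeal A α x) (hy : y ∈ x.els) (hz : z ∈ x.els) :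
    ∃ w ∈ x.els, y ≤ w ∧ z ≤ w := by
  cases h with
  | ur hq =>
    rw [HSet.els_ur] at hy hz
    subst hy hz
    simp
  | set hβ hx hne hmem hdir =>
    rw [HSet.mem_els_of_isSet hx] at hy hz
    obtain ⟨w, hw, h⟩ := hdir y hy z hz
    exact ⟨w, (HSet.mem_els_of_isSet hx).2 hw, h⟩

theorem exists_lt_of_isSet (h : IterIdeal A α x) (hx : x.IsSet) :
    ∃ β < α, ∀ y ∈ x, IterIdeal A β y := by
  cases h with
  | ur hq => exact (HSet.not_isSet_ur _ hx).elim
  | set hβ _ _ hmem _ => exact ⟨_, hβ, hmem⟩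

theorem mem_of_ur {q : Q} (h : IterIdeal A α (HSet.ur q)) : q ∈ A := by
  generalize hz : HSet.ur q = z at h
  cases h with
  | ur hq => exact HSet.ur_injective hz ▸ hq
  | set _ hx => exact (HSet.not_isSet_ur q (hz ▸ hx)).elim

/-- A set of stage `α` is determined by a subset of the union of the earlier stages, which is small
by induction. -/
theorem small (A : Set Q) (α : Ordinal.{u}) : Small.{u} {x : HSet Q | IterIdeal A α x} := by
  induction α using WellFoundedLT.induction with
  | ind α ih =>
    have h1 : Small.{u} (⋃ β : Set.Iio α, {x : HSet Q | IterIdeal A β.1 x}) := by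
      have := fun β : Set.Iio α => ih β.1 β.2
      exact small_iUnion _
    set U := ⋃ β : Set.Iio α, {x : HSet Q | IterIdeal A β.1 x} with hU
    have h2 : Small.{u} (Q ⊕ Set U) := inferInstance
    let f : Q ⊕ Set U → HSet Q := Sum.elim HSet.ur
      fun s => Classical.choose (HSet.exists_isSet_mem_iff (Subtype.val '' s))
    refine small_subset (s := Set.range f) ?_
    intro x hx
    rcases hx with @⟨_, q, hq⟩ | @⟨_, β, x, hβ, hx, hne, hmem, hdir⟩
    · exact ⟨.inl q, rfl⟩
    · refine ⟨.inr {y | y.1 ∈ x}, ?_⟩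
      have := Classical.choose_spec
        (HSet.exists_isSet_mem_iff (Subtype.val '' {y : U | y.1 ∈ x}))
      refine HSet.ext this.1 hx fun z => (this.2 z).trans ⟨?_, fun hz => ?_⟩
      · rintro ⟨y, hy, rfl⟩
        exact hy
      · exact ⟨⟨z, Set.mem_iUnion.2 ⟨⟨β, hβ⟩, hmem z hz⟩⟩, hz, rfl⟩

end IterIdeal

/-! ## Comparison of products of words -/

namespace FreeMonoid

variable {P : Type u} [Preorder P]

theorem le_iff_sublistForall₂ {x y : FreeMonoid P} :
    x ≤ y ↔ List.SublistForall₂ (· ≤ ·) x.toList y.toList := Iff.rfl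

theorem sublistForall₂_of_append {x y b : List P}
    (h : List.SublistForall₂ (· ≤ ·) (x ++ y) b) : List.SublistForall₂ (· ≤ ·) y b :=
  trans_of (List.SublistForall₂ (α := P) (· ≤ ·)) (List.sublist_append_right x y).sublistForall₂ h

/-- The part of `x * y` that an embedding sends into `a` is an initial segment: either it contains
`x`, or the rest contains `y`. -/
theorem le_or_le_of_mul_le_mul {x y a b : FreeMonoid P} (h : x * y ≤ a * b) : x ≤ a ∨ y ≤ b := by
  rw [le_iff_sublistForall₂, toList_mul, toList_mul] at h
  simp only [le_iff_sublistForall₂]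
  generalize x.toList = x, y.toList = y, a.toList = a, b.toList = b at h ⊢
  induction a generalizing x with
  | nil =>
    exact .inr (sublistForall₂_of_append h)
  | cons c a ih =>
    cases x with
    | nil => exact .inl .nil
    | cons p x =>
      cases h with
      | cons hp h => exact (ih x h).imp_left (.cons hp)
      | cons_right h => exact (ih (p :: x) h).imp_left .cons_right

/-- The first letter `p` finds no place in `a`, so everything goes into `b`. -/
theorem of_mul_le_of_not_le {p : P} {c a b : FreeMonoid P} (h : of p * c ≤ a * b)
    (ha : ¬ of p ≤ a) : of p * c ≤ b := by
  simp only [le_iff_sublistForall₂, toList_mul, toList_of, List.singleton_append] at h ha ⊢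
  generalize c.toList = c, a.toList = a, b.toList = b at h ha ⊢
  induction a with
  | nil => exact h
  | cons d a ih =>
    cases h with
    | cons hp h => exact (ha (.cons hp .nil)).elim
    | cons_right h => exact ih h fun h' => ha h'.cons_right

/-- At most one letter can be sent to `q`; it would be the first letter of the non-empty word `x`,
so `c` goes into `b`. -/
theorem le_of_mul_le_of_mul {x c b : FreeMonoid P} {q : P} (h : x * c ≤ of q * b)
    (hx : ¬ x ≤ 1) : c ≤ b := by
  simp only [le_iff_sublistForall₂, toList_mul, toList_of, List.singleton_append,
    toList_one] at h hx ⊢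
  generalize c.toList = c, x.toList = x, b.toList = b at h hx ⊢
  cases x with
  | nil => exact (hx .nil).elim
  | cons p x =>
    cases h with
    | cons hp h => exact sublistForall₂_of_append h
    | cons_right h => exact sublistForall₂_of_append (x := p :: x) h

theorem not_of_le_one (p : P) : ¬ of p ≤ 1 := by
  intro h
  rw [le_iff_sublistForall₂, toList_of, toList_one] at h
  cases h

end FreeMonoid

/-! ## Comparison of products of sets of words -/

namespace HSet

variable {P : Type u} [Preorder P]

/-- If both alternatives fail, witnesses `x'` and `y'` of the two failures violate the induction
hypothesis at the product `a' * b'` above `x' * y'`. -/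
theorem le_or_le_of_mul_le_mul {x y a b : HSet (FreeMonoid P)} (h : x * y ≤ a * b) :
    x ≤ a ∨ y ≤ b := by
  induction x, y, a, b using induction₄ with
  | h_ur p q r s => exact FreeMonoid.le_or_le_of_mul_le_mul h
  | h_els x y a b ih =>
    by_contra! H
    obtain ⟨⟨x', hx, hxa⟩, y', hy, hyb⟩ := H.imp not_le_iff_els.1 not_le_iff_els.1
    obtain ⟨_, ha, hle⟩ := le_iff_els.1 h _ (mul_mem_els hx hy)
    rw [els_mul] at ha
    obtain ⟨a', ha, b', hb, rfl⟩ := ha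
    rcases ih x' hx y' hy a' ha b' hb hle with h | h
    · exact hxa a' ha h
    · exact hyb b' hb h

/-- `x` is an iterated ideal over `P`. -/
def IsLetterIdeal (x : HSet (FreeMonoid P)) : Prop :=
  ∃ α, IterIdeal (Set.range FreeMonoid.of) α x

theorem IsLetterIdeal.of_mem_els {x y : HSet (FreeMonoid P)} (h : x.IsLetterIdeal)
    (hy : y ∈ x.els) : y.IsLetterIdeal := h.imp fun _ h => h.of_mem_els hy

theorem IsLetterIdeal.exists_of {q : FreeMonoid P} (h : (ur q).IsLetterIdeal) :
    ∃ p, FreeMonoid.of p = q := h.choose_spec.mem_of_ur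

theorem IsLetterIdeal.not_le_one {x : HSet (FreeMonoid P)} (h : x.IsLetterIdeal) : ¬ x ≤ 1 := by
  induction x using induction with
  | h_ur q =>
    obtain ⟨p, rfl⟩ := h.exists_of
    exact FreeMonoid.not_of_le_one p
  | h_range ι f ih =>
    obtain ⟨y, hy⟩ := h.choose_spec.els_nonempty
    have hy' := hy
    rw [els_range] at hy
    obtain ⟨i, rfl⟩ := hy
    exact fun hle => ih i (h.of_mem_els hy') ((le_of_mem_els hy').trans hle)

/-- Directedness of `x` is essential: a witness `x₀` of `x ≰ a` and an arbitrary `x₁ ∈ els x` have a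
common upper bound `x₂` in `els x`, which is again a witness and to which the induction hypothesis
applies. -/
theorem IsLetterIdeal.mul_le_of_not_le {x c a b : HSet (FreeMonoid P)} (hx : x.IsLetterIdeal)
    (h : x * c ≤ a * b) (ha : ¬ x ≤ a) : x * c ≤ b := by
  induction x, c, a, b using induction₄ with
  | h_ur p q r s =>
    obtain ⟨p, rfl⟩ := hx.exists_of
    exact FreeMonoid.of_mul_le_of_not_le h ha
  | h_els x c a b ih =>
    obtain ⟨x₀, hx₀, hxa⟩ := not_le_iff_els.1 ha
    rw [le_iff_els]
    intro z hz
    rw [els_mul] at hz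
    obtain ⟨x₁, hx₁, c', hc, rfl⟩ := hz
    obtain ⟨x₂, hx₂, h₀₂, h₁₂⟩ := hx.choose_spec.els_directed hx₀ hx₁
    obtain ⟨_, hab, hle⟩ := le_iff_els.1 h _ (mul_mem_els hx₂ hc)
    rw [els_mul] at hab
    obtain ⟨a', ha', b', hb', rfl⟩ := hab
    exact ⟨b', hb', (mul_le_mul_right' c' h₁₂).trans <| ih x₂ hx₂ c' hc a' ha' b' hb'
      (hx.of_mem_els hx₂) hle fun h => hxa a' ha' (h₀₂.trans h)⟩

/-- Here `x` need not be directed: a single element `x' ≰ 1` serves all elements of `c`. -/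
theorem IsLetterIdeal.le_of_mul_le_mul {x c a b : HSet (FreeMonoid P)} (ha : a.IsLetterIdeal)
    (h : x * c ≤ a * b) (hx : ¬ x ≤ 1) : c ≤ b := by
  induction x, c, a, b using induction₄ with
  | h_ur p q r s =>
    obtain ⟨r, rfl⟩ := ha.exists_of
    exact FreeMonoid.le_of_mul_le_of_mul h hx
  | h_els x c a b ih =>
    obtain ⟨x', hx', hx1⟩ := not_le_iff_els.1 hx
    rw [le_iff_els]
    intro c' hc
    obtain ⟨_, hab, hle⟩ := le_iff_els.1 h _ (mul_mem_els hx' hc)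
    rw [els_mul] at hab
    obtain ⟨a', ha', b', hb', rfl⟩ := hab
    exact ⟨b', hb', ih x' hx' c' hc a' ha' b' hb' (ha.of_mem_els ha') hle (hx1 1 (by simp))⟩

theorem IsLetterIdeal.le_one_or_le_one {x y a : HSet (FreeMonoid P)} (ha : a.IsLetterIdeal)
    (h : x * y ≤ a) : x ≤ 1 ∨ y ≤ 1 := by
  by_contra! H
  rw [← mul_one a] at h
  exact H.2 (ha.le_of_mul_le_mul h H.1)

end HSet

/-! ## The generalized Higman ordering by recursion -/

/-- A recursive description of the generalized Higman ordering. -/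
inductive HigmanRel {L : Type u} [Preorder L] (Li : Set L) : List L → List L → Prop
  | nil (v : List L) : HigmanRel Li [] v
  | skip {u v : List L} (y : L) (h : HigmanRel Li u v) : HigmanRel Li u (y :: v)
  | one {x y : L} {u v : List L} (hxy : x ≤ y) (h : HigmanRel Li u v) :
      HigmanRel Li (x :: u) (y :: v)
  | many {x y : L} {u v : List L} (hxy : x ≤ y) (hy : y ∈ Li) (h : HigmanRel Li u (y :: v)) :
      HigmanRel Li (x :: u) (y :: v)

namespace GenHigman

variable {L : Type u} [Preorder L] {Li : Set L}

theorem Le.of_rel {u v : List L} (h : HigmanRel Li u v) : Le Li u v := by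
  induction h with
  | nil v =>
    exact le_iff.2 ⟨fun i => i.elim0, fun i => i.elim0, fun i => i.elim0, fun i => i.elim0⟩
  | @skip u v y h ih =>
    obtain ⟨f, hf, hle, hfib⟩ := le_iff.1 ih
    exact le_iff.2 ⟨fun i => (f i).succ, fun i j hij => Fin.succ_le_succ_iff.2 (hf hij),
      fun i => hle i, fun i j hne he => hfib i j hne (Fin.succ_injective _ he)⟩
  | @one x y u v hxy h ih =>
    obtain ⟨f, hf, hle, hfib⟩ := le_iff.1 ih
    refine le_iff.2 ⟨Fin.cons 0 fun i => (f i).succ, ?_, ?_, ?_⟩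
    · intro i j hij
      induction i using Fin.cases with
      | zero => exact Fin.zero_le _
      | succ i =>
        induction j using Fin.cases with
        | zero => exact absurd hij (by simp)
        | succ j => exact Fin.succ_le_succ_iff.2 (hf (Fin.succ_le_succ_iff.1 hij))
    · intro i
      induction i using Fin.cases with
      | zero => exact hxy
      | succ i => exact hle i
    · intro i j hne he
      induction i using Fin.cases with
      | zero =>
        induction j using Fin.cases with
        | zero => exact (hne rfl).elim
        | succ j => exact ((Fin.succ_ne_zero _).symm he).elim
      | succ i =>
        induction j using Fin.cases with
        | zero => exact (Fin.succ_ne_zero _ he).elim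
        | succ j => exact hfib i j (fun e => hne (congrArg _ e)) (Fin.succ_injective _ he)
  | @many x y u v hxy hy h ih =>
    obtain ⟨f, hf, hle, hfib⟩ := le_iff.1 ih
    refine le_iff.2 ⟨Fin.cons 0 f, ?_, ?_, ?_⟩
    · intro i j hij
      induction i using Fin.cases with
      | zero => exact Fin.zero_le _
      | succ i =>
        induction j using Fin.cases with
        | zero => exact absurd hij (by simp)
        | succ j => exact hf (Fin.succ_le_succ_iff.1 hij)
    · intro i
      induction i using Fin.cases with
      | zero => exact hxy
      | succ i => exact hle i
    · intro i j hne he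
      induction i using Fin.cases with
      | zero => exact hy
      | succ i =>
        induction j using Fin.cases with
        | zero =>
          have he' : f i = 0 := he
          change (y :: v).get (f i) ∈ Li
          rw [he']
          exact hy
        | succ j => exact hfib i j (fun e => hne (congrArg _ e)) he

/-- Look at the position `0` of `v`: if `f` misses it, skip it; if only the first letter of `u` goes
there, both are removed; if further letters go there, the fibre condition puts `y` into `Li` and `y`
is kept. -/
theorem Le.rel {u v : List L} (h : Le Li u v) : HigmanRel Li u v := by
  obtain ⟨f, hf, hle, hfib⟩ := le_iff.1 h
  clear h
  induction v generalizing u with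
  | nil =>
    cases u with
    | nil => exact .nil _
    | cons x u => exact (f 0).elim0
  | cons y v ihv =>
    -- A map that avoids position `0` is a map into the positions of `v`, shifted by one.
    have tail : ∀ (w : List L) (g : Fin w.length → Fin (y :: v).length), Monotone g →
        (∀ i, w.get i ≤ (y :: v).get (g i)) →
        (∀ i i', i ≠ i' → g i = g i' → (y :: v).get (g i) ∈ Li) → (∀ i, g i ≠ 0) →
        HigmanRel Li w v := by
      intro w g hg hle hfib h0
      have hs : ∀ i, ((g i).pred (h0 i)).succ = g i := fun i => Fin.succ_pred _ _
      refine ihv (fun i => (g i).pred (h0 i)) (fun i j hij => Fin.pred_le_pred_iff.2 (hg hij))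
        (fun i => ?_) (fun i i' hne he => ?_)
      · have := hle i
        rw [← hs i] at this
        exact this
      · have := hfib i i' hne (Fin.pred_inj.1 he)
        rw [← hs i] at this
        exact this
    induction u with
    | nil => exact .nil _
    | cons x u ihu =>
      have hf' : Monotone fun i : Fin u.length => f i.succ :=
        fun i j hij => hf (Fin.succ_le_succ_iff.2 hij)
      have hfib' : ∀ i i' : Fin u.length, i ≠ i' → f i.succ = f i'.succ →
          (y :: v).get (f i.succ) ∈ Li :=
        fun i i' hne he => hfib i.succ i'.succ (fun e => hne (Fin.succ_injective _ e)) he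
      by_cases h0 : f 0 = 0
      · have hxy : x ≤ y := by
          have := hle 0
          rw [h0] at this
          exact this
        by_cases h1 : ∃ i : Fin u.length, f i.succ = 0
        · obtain ⟨i, hi⟩ := h1
          refine .many hxy ?_ (ihu (fun i => f i.succ) hf' (fun i => hle i.succ) hfib')
          have := hfib 0 i.succ (Fin.succ_ne_zero i).symm (h0.trans hi.symm)
          rw [h0] at this
          exact this
        · push Not at h1
          exact .one hxy (tail u (fun i => f i.succ) hf' (fun i => hle i.succ) hfib' h1)
      · refine .skip y (tail (x :: u) f hf hle hfib fun i hi => h0 ?_)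
        exact Fin.le_zero_iff.1 (hi ▸ hf (Fin.zero_le i))

theorem le_iff_rel {u v : List L} : Le Li u v ↔ HigmanRel Li u v := ⟨Le.rel, Le.of_rel⟩

/-- Ordinary embeddings are the case of injective maps; therefore Higman's lemma carries over to the
generalized ordering. -/
theorem Le.of_sublistForall₂ {u v : List L} (h : List.SublistForall₂ (· ≤ ·) u v) : Le Li u v := by
  rw [le_iff_rel]
  induction h with
  | nil => exact .nil _
  | cons h _ ih => exact .one h ih
  | cons_right _ ih => exact .skip _ ih

end GenHigman

/-! ## The partition theorem for barred sets of increasing sequences -/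

/-- The predicate `c` on increasing sequences of natural numbers is decided by a well-founded tree
of initial segments above the initial segment of `s` of length `k`. -/
inductive Barred (c : (ℕ → ℕ) → Prop) : ℕ → (ℕ → ℕ) → Prop
  | leaf {k : ℕ} {s : ℕ → ℕ}
      (h : ∀ t, StrictMono t → (∀ i < k, t i = s i) → (c t ↔ c s)) : Barred c k s
  | node {k : ℕ} {s : ℕ → ℕ}
      (h : ∀ t, StrictMono t → (∀ i < k, t i = s i) → Barred c (k + 1) t) : Barred c k s

/-- Nash-Williams' partition theorem. -/
theorem Barred.exists_homogeneous {c : (ℕ → ℕ) → Prop} {k : ℕ} {s : ℕ → ℕ} (h : Barred c k s)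
    {A : Set ℕ} (hA : A.Infinite) : ∃ B ⊆ A, B.Infinite ∧ ∃ b : Prop, ∀ t, StrictMono t →
      (∀ i < k, t i = s i) → (∀ i, k ≤ i → t i ∈ B) → (c t ↔ b) := by
  induction h generalizing A with
  | @leaf k s h => exact ⟨A, subset_rfl, hA, c s, fun t ht h1 _ => h t ht h1⟩
  | @node k s h ih =>
    -- Thin out `A` so that `c` becomes constant on the continuations whose next value is `n`. If no
    -- increasing sequence continues by `n`, there is nothing to do.
    have step : ∀ (n : ℕ) (A : {A : Set ℕ // A.Infinite}), ∃ B : {A : Set ℕ // A.Infinite},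
        B.1 ⊆ A.1 ∧ ∃ b : Prop, ∀ t, StrictMono t → (∀ i < k, t i = s i) → t k = n →
          (∀ i, k + 1 ≤ i → t i ∈ B.1) → (c t ↔ b) := by
      intro n A
      by_cases hn : ∃ t, StrictMono t ∧ (∀ i < k, t i = s i) ∧ t k = n
      · obtain ⟨t, ht, hts, htn⟩ := hn
        obtain ⟨B, hBA, hB, b, hb⟩ := ih t ht hts A.2
        refine ⟨⟨B, hB⟩, hBA, b, fun t' ht' h1 h2 h3 => hb t' ht' (fun i hi => ?_) h3⟩
        rcases Nat.lt_succ_iff_lt_or_eq.1 hi with hi | rfl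
        · rw [h1 i hi, hts i hi]
        · rw [h2, htn]
      · exact ⟨A, subset_rfl, True, fun t ht h1 h2 => (hn ⟨t, ht, h1, h2⟩).elim⟩
    choose B hBA b hb using step
    have hIoi : ∀ (A : {A : Set ℕ // A.Infinite}) (n : ℕ), (A.1 \ Set.Iic n).Infinite :=
      fun A n => A.2.sdiff (Set.finite_Iic n)
    -- Fusion: choose `a n` in `D n`, and let `D (n + 1)` be a subset of `D n` above `a n` that is
    -- homogeneous for the next value `a n`.
    let next : {A : Set ℕ // A.Infinite} → {A : Set ℕ // A.Infinite} := fun A =>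
      B A.2.nonempty.some ⟨_, hIoi A A.2.nonempty.some⟩
    let D : ℕ → {A : Set ℕ // A.Infinite} := fun n => next^[n] ⟨A, hA⟩
    let a : ℕ → ℕ := fun n => (D n).2.nonempty.some
    have ha : ∀ n, a n ∈ (D n).1 := fun n => (D n).2.nonempty.some_mem
    have hD : ∀ n, (D (n + 1)).1 = (B (a n) ⟨_, hIoi (D n) (a n)⟩).1 := fun n => by
      simp only [D, Function.iterate_succ_apply']
      rfl
    have hsub : ∀ n, (D (n + 1)).1 ⊆ (D n).1 \ Set.Iic (a n) := fun n => by
      rw [hD]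
      exact hBA _ _
    have hanti : Antitone fun n => (D n).1 :=
      antitone_nat_of_succ_le fun n => (hsub n).trans Set.sdiff_subset
    have hmono : StrictMono a := strictMono_nat_of_lt_succ fun n =>
      not_le.1 (hsub n (ha (n + 1))).2
    let β : ℕ → Prop := fun n => b (a n) ⟨_, hIoi (D n) (a n)⟩
    -- The constant truth value still depends on the next value `a j`; it is made uniform by the
    -- pigeonhole principle.
    obtain ⟨J, hJ, b', hb'⟩ : ∃ J : Set ℕ, J.Infinite ∧ ∃ b', ∀ j ∈ J, (β j ↔ b') := by
      by_cases hJ : {j | β j}.Infinite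
      · exact ⟨_, hJ, True, fun j hj => iff_true_intro hj⟩
      · exact ⟨_, (Set.not_infinite.1 hJ).infinite_compl, False, fun j hj => iff_false_intro hj⟩
    refine ⟨a '' J, ?_, hJ.image hmono.injective.injOn, b', fun t ht h1 h2 => ?_⟩
    · rintro _ ⟨j, -, rfl⟩
      exact hanti (Nat.zero_le j) (ha j)
    · obtain ⟨j, hj, hjk⟩ := h2 k le_rfl
      refine (hb _ _ t ht h1 hjk.symm fun i hi => ?_).trans (hb' j hj)
      obtain ⟨l, -, hl⟩ := h2 i (by omega)
      rw [← hD, ← hl]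
      refine hanti (?_ : j + 1 ≤ l) (ha l)
      rw [Nat.succ_le_iff, ← hmono.lt_iff_lt, hjk, hl]
      exact ht (by omega)

/-! ## Fronts of initial segments of increasing sequences -/

/-- The set of the first `n` values of `s`. -/
def initVals (s : ℕ → ℕ) (n : ℕ) : Finset ℕ := (Finset.range n).image s

@[simp] theorem mem_initVals {s : ℕ → ℕ} {n x : ℕ} : x ∈ initVals s n ↔ ∃ i < n, s i = x := by
  simp [initVals]

theorem initVals_congr {s t : ℕ → ℕ} {n : ℕ} (h : ∀ i < n, s i = t i) :
    initVals s n = initVals t n :=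
  Finset.image_congr fun i hi => h i (by simpa using hi)

theorem IsInitSeg.of_eq {s t : Set ℕ} (h : s = t) : IsInitSeg s t :=
  h ▸ ⟨subset_rfl, fun _ _ _ hy _ => hy⟩

theorem card_initVals {s : ℕ → ℕ} (hs : StrictMono s) (n : ℕ) : (initVals s n).card = n := by
  rw [initVals, Finset.card_image_of_injective _ hs.injective, Finset.card_range]

theorem agree_of_isInitSeg {s t : ℕ → ℕ} (hs : StrictMono s) (ht : StrictMono t) {m n : ℕ}
    (h : IsInitSeg (initVals s m) (initVals t n)) : m ≤ n ∧ ∀ i < m, s i = t i := by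
  constructor
  · rw [← card_initVals hs m, ← card_initVals ht n]
    exact Finset.card_le_card (by exact_mod_cast h.1)
  intro i
  induction i using Nat.strong_induction_on with
  | _ i ih =>
    intro hi
    have hmem : s i ∈ initVals s m := mem_initVals.2 ⟨i, hi, rfl⟩
    obtain ⟨j, hj, hji⟩ := mem_initVals.1 (h.1 hmem)
    rcases lt_trichotomy i j with hij | rfl | hij
    · have hlt : t i < s i := hji ▸ ht hij
      obtain ⟨l, hl, hli⟩ := mem_initVals.1
        (h.2 (s i) hmem (t i) (mem_initVals.2 ⟨i, hij.trans hj, rfl⟩) hlt)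
      have hli' : l < i := hs.lt_iff_lt.1 (hli ▸ hlt)
      rw [ih l hli' hl] at hli
      exact (hli'.ne (ht.injective hli)).elim
    · exact hji.symm
    · rw [← ih j hij (hij.trans hi)] at hji
      exact (hij.ne (hs.injective hji)).elim

theorem exists_initVals_of_isInitSeg {s : ℕ → ℕ} (hs : StrictMono s) {n : ℕ} {σ : Finset ℕ}
    (h : IsInitSeg σ (initVals s n)) : ∃ m ≤ n, σ = initVals s m := by
  have hex : ∃ m, s m ∉ σ := by
    refine ⟨n, fun hn => ?_⟩
    obtain ⟨i, hi, he⟩ := mem_initVals.1 (h.1 hn)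
    exact hi.ne (hs.injective he)
  have key : σ = initVals s (Nat.find hex) := by
    ext x
    rw [mem_initVals]
    constructor
    · intro hx
      obtain ⟨i, hi, rfl⟩ := mem_initVals.1 (h.1 hx)
      refine ⟨i, ?_, rfl⟩
      by_contra! hle
      rcases hle.eq_or_lt with he | hlt
      · exact Nat.find_spec hex (he ▸ hx)
      · exact Nat.find_spec hex (h.2 _ hx _ (mem_initVals.2 ⟨_, hlt.trans hi, rfl⟩) (hs hlt))
    · rintro ⟨i, hi, rfl⟩
      exact not_not.1 (Nat.find_min hex hi)
  refine ⟨_, ?_, key⟩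
  rw [← card_initVals hs (Nat.find hex), ← key, ← card_initVals hs n]
  exact Finset.card_le_card (by exact_mod_cast h.1)

theorem isInitSeg_initVals_range {s : ℕ → ℕ} (hs : StrictMono s) (n : ℕ) :
    IsInitSeg (initVals s n) (Set.range s) := by
  constructor
  · intro x hx
    obtain ⟨i, -, rfl⟩ := mem_initVals.1 hx
    exact ⟨i, rfl⟩
  · rintro x hx _ ⟨j, rfl⟩ hlt
    obtain ⟨i, hi, rfl⟩ := mem_initVals.1 hx
    exact mem_initVals.2 ⟨j, (hs.lt_iff_lt.1 hlt).trans hi, rfl⟩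

/-- A function that assigns to every increasing sequence the length of an initial segment of it on
which it depends determines a front. -/
theorem exists_front (N : (ℕ → ℕ) → ℕ)
    (hN : ∀ s t, StrictMono s → StrictMono t → (∀ i ≤ N s, t i = s i) → N t = N s)
    (R : ℕ → (ℕ → ℕ) → Ordinal.{v}) {α : Ordinal.{v}}
    (hR : ∀ k s t, (∀ i ≤ k, t i = s i) → R k t = R k s)
    (hlt : ∀ s, StrictMono s → ∀ k, k + 1 < N s → R (k + 1) s < R k s)
    (hα : ∀ s, StrictMono s → 0 < N s → R 0 s < α) :
    ∃ F : Front.{v}, F.carrier = {σ | ∃ s, StrictMono s ∧ σ = initVals s (N s + 1)} ∧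
      F.rk ∅ = α := by
  classical
  -- A segment of length `k + 1` gets `R k`, which depends on its entries only, and `∅` gets `α`.
  -- Members of the front have length `N s + 1`, so that the non-empty proper segments correspond to
  -- `k < N s`.
  let rk : Finset ℕ → Ordinal.{v} := fun σ =>
    if h : ∃ p : ℕ × (ℕ → ℕ), StrictMono p.2 ∧ σ = initVals p.2 (p.1 + 1) then
      R h.choose.1 h.choose.2 else α
  have rk_empty : rk ∅ = α := by
    refine dif_neg ?_
    rintro ⟨p, -, hp⟩
    have : p.2 0 ∈ initVals p.2 (p.1 + 1) := mem_initVals.2 ⟨0, by omega, rfl⟩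
    rw [← hp] at this
    simp at this
  have rk_initVals : ∀ k s, StrictMono s → rk (initVals s (k + 1)) = R k s := by
    intro k s hs
    have h : ∃ p : ℕ × (ℕ → ℕ), StrictMono p.2 ∧ initVals s (k + 1) = initVals p.2 (p.1 + 1) :=
      ⟨(k, s), hs, rfl⟩
    have h1 := h.choose_spec
    rw [show rk (initVals s (k + 1)) = R h.choose.1 h.choose.2 from dif_pos h]
    have hc := congrArg Finset.card h1.2
    rw [card_initVals hs, card_initVals h1.1] at hc
    have hk : h.choose.1 = k := by omega
    rw [hk] at h1 ⊢
    refine hR k s _ fun i hi => ?_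
    exact ((agree_of_isInitSeg hs h1.1 (.of_eq (congrArg _ h1.2))).2 i (by omega)).symm
  have anti : ∀ s, StrictMono s → ∀ a b, a < b → b < N s → R b s < R a s := by
    intro s hs a b hab
    induction b, hab using Nat.le_induction with
    | base => exact fun h => hlt s hs a h
    | succ b _ ih => exact fun h => (hlt s hs b h).trans (ih (by omega))
  have anti' : ∀ s, StrictMono s → ∀ b, b < N s → R b s < α := by
    intro s hs b hb
    rcases Nat.eq_zero_or_pos b with rfl | h
    · exact hα s hs hb
    · exact (anti s hs 0 b h hb).trans (hα s hs (by omega))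
  have proper : ∀ σ : Finset ℕ, (∃ ρ ∈ {σ | ∃ s, StrictMono s ∧ σ = initVals s (N s + 1)},
      IsInitSeg σ ρ ∧ σ ≠ ρ) → ∃ s, StrictMono s ∧ ∃ j ≤ N s, σ = initVals s j := by
    rintro σ ⟨_, ⟨s, hs, rfl⟩, hσ, hne⟩
    obtain ⟨j, hj, rfl⟩ := exists_initVals_of_isInitSeg hs hσ
    refine ⟨s, hs, j, ?_, rfl⟩
    have : j ≠ N s + 1 := fun h => hne (h ▸ rfl)
    omega
  refine ⟨⟨{σ | ∃ s, StrictMono s ∧ σ = initVals s (N s + 1)}, ?_, ?_, ?_, rk, ?_⟩, rfl, rk_empty⟩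
  · have hs : ∀ n : ℕ, StrictMono fun i => n + i := fun n _ _ h => Nat.add_lt_add_left h n
    refine Set.infinite_of_injective_forall_mem
      (f := fun n => initVals (fun i => n + i) (N (fun i => n + i) + 1)) ?_
      fun n => ⟨_, hs n, rfl⟩
    intro m n h
    have h' : initVals (fun i => m + i) (N (fun i => m + i) + 1) =
      initVals (fun i => n + i) (N (fun i => n + i) + 1) := h
    exact (agree_of_isInitSeg (hs m) (hs n) (.of_eq (congrArg _ h'))).2 0 (by omega)
  · rintro _ ⟨s, hs, rfl⟩ _ ⟨t, ht, rfl⟩ h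
    obtain ⟨-, h2⟩ := agree_of_isInitSeg hs ht h
    rw [hN s t hs ht fun i hi => (h2 i (by omega)).symm]
    exact initVals_congr h2
  · intro X hX _
    have hs : StrictMono (Nat.nth (· ∈ X)) := Nat.nth_strictMono hX
    have hr : Set.range (Nat.nth (· ∈ X)) = X := Nat.range_nth_of_infinite hX
    refine ⟨_, ⟨_, hs, rfl⟩, ?_⟩
    have := isInitSeg_initVals_range hs (N (Nat.nth (· ∈ X)) + 1)
    rwa [hr] at this
  · intro σ τ hσ hτ hστ hne
    obtain ⟨s, hs, j, hj, rfl⟩ := proper σ hσ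
    obtain ⟨t, ht, l, hl, rfl⟩ := proper τ hτ
    obtain ⟨h1, h2⟩ := agree_of_isInitSeg hs ht hστ
    rw [initVals_congr h2] at hne ⊢
    have hjl : j ≠ l := fun h => hne (h ▸ rfl)
    obtain ⟨l, rfl⟩ : ∃ l', l = l' + 1 := ⟨l - 1, by omega⟩
    rw [rk_initVals l t ht]
    rcases j with _ | j
    · rw [show initVals t 0 = ∅ from rfl, rk_empty]
      exact anti' t ht l (by omega)
    · rw [rk_initVals j t ht]
      exact anti t ht j l (by omega) (by omega)

/-- Turns `◁` into a shift: one increasing sequence `r` starts like `s`, and its shift starts like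
`t`. According to which segment is longer, `r` is `s 0` followed by `t`, or `s` itself. -/
theorem exists_of_frontShift {s t : ℕ → ℕ} (hs : StrictMono s) (ht : StrictMono t) {m n : ℕ}
    (h : FrontShift (initVals s (m + 1)) (initVals t (n + 1))) :
    ∃ r, StrictMono r ∧ (∀ i ≤ m, r i = s i) ∧ ∀ i ≤ n, r (i + 1) = t i := by
  obtain ⟨h1, h2, hmin, h⟩ := h
  have hmin' : ∀ {s : ℕ → ℕ} (_ : StrictMono s) {m : ℕ} (h : (initVals s (m + 1)).Nonempty),
      (initVals s (m + 1)).min' h = s 0 := by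
    intro s hs m h
    refine le_antisymm (Finset.min'_le _ _ (mem_initVals.2 ⟨0, by omega, rfl⟩)) ?_
    refine Finset.le_min' _ _ _ fun y hy => ?_
    obtain ⟨i, -, rfl⟩ := mem_initVals.1 hy
    exact hs.monotone (Nat.zero_le i)
  rw [hmin' hs, hmin' ht] at hmin
  have herase : (initVals s (m + 1)).erase (s 0) = initVals (fun i => s (i + 1)) m := by
    ext x
    simp only [Finset.mem_erase, mem_initVals]
    constructor
    · rintro ⟨hne, i, hi, rfl⟩
      rcases i with _ | i
      · exact (hne rfl).elim
      · exact ⟨i, by omega, rfl⟩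
    · rintro ⟨i, hi, rfl⟩
      exact ⟨(hs (Nat.succ_pos i)).ne', i + 1, by omega, rfl⟩
  rw [hmin' hs, herase] at h
  have hs' : StrictMono fun i => s (i + 1) := fun i j hij => hs (Nat.succ_lt_succ hij)
  rcases h with h | h
  · have h3 := (agree_of_isInitSeg hs' ht h).2
    refine ⟨fun i => Nat.casesOn i (s 0) t, strictMono_nat_of_lt_succ fun i => ?_, fun i hi => ?_,
      fun i _ => rfl⟩
    · rcases i with _ | i
      · exact hmin
      · exact ht (Nat.lt_succ_self i)
    · rcases i with _ | i
      · rfl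
      · exact (h3 i (by omega)).symm
  · have h3 := (agree_of_isInitSeg ht hs' h).2
    exact ⟨s, hs, fun i _ => rfl, fun i hi => (h3 i (by omega)).symm⟩

/-! ## Descent along a well-founded hierarchy -/

/-- A relation `le` on a type whose elements are hereditarily built from terminal elements, such
that failures of `le` descend to elements. -/
structure Descent (V : Type u) (P : Type v) [Preorder P] (α : Ordinal.{v}) where
  le : V → V → Prop
  elts : V → Set V
  term : V → Prop
  val : V → Option P
  rank : V → Ordinal.{v}
  exists_elts : ∀ v w, ¬ le v w → ∃ v' ∈ elts v, ∀ w' ∈ elts w, ¬ le v' w'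
  elts_of_term : ∀ v, term v → elts v = {v}
  rank_lt : ∀ v, ¬ term v → ∀ v' ∈ elts v, ¬ term v' → rank v' < rank v
  rank_lt_of_not_term : ∀ v, ¬ term v → rank v < α
  le_of_none : ∀ v w, term v → term w → val v = none → val w = none → le v w
  le_of_some : ∀ v w, term v → term w → ∀ p ∈ val v, ∀ q ∈ val w, p ≤ q → le v w

namespace Descent

variable {V : Type u} {P : Type v} [Preorder P] {α : Ordinal.{v}} (D : Descent V P α)

open Classical in
/-- An element of `v` witnessing that `v` is not below `w`. -/
noncomputable def pick (v w : V) : V :=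
  if h : ∃ v' ∈ D.elts v, ∀ w' ∈ D.elts w, ¬ D.le v' w' then h.choose else v

theorem pick_spec {v w : V} (h : ¬ D.le v w) :
    D.pick v w ∈ D.elts v ∧ ∀ w' ∈ D.elts w, ¬ D.le (D.pick v w) w' := by
  have h' := D.exists_elts v w h
  rw [pick, dif_pos h']
  exact h'.choose_spec

/-- The descent from the sequence `t`. -/
noncomputable def desc : ℕ → (ℕ → V) → V
  | 0, t => t 0
  | k + 1, t => D.pick (desc k t) (desc k fun i => t (i + 1))

theorem desc_congr {k : ℕ} {s t : ℕ → V} (h : ∀ i ≤ k, s i = t i) : D.desc k s = D.desc k t := by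
  induction k generalizing s t with
  | zero => exact h 0 le_rfl
  | succ k ih =>
    exact congrArg₂ D.pick (ih fun i hi => h i (by omega)) (ih fun i hi => h (i + 1) (by omega))

/-- The sequence `t` is bad. -/
def Bad (t : ℕ → V) : Prop := ∀ i j, i < j → ¬ D.le (t i) (t j)

variable {D} {s t : ℕ → V}

theorem Bad.comp (h : D.Bad t) {f : ℕ → ℕ} (hf : StrictMono f) : D.Bad (t ∘ f) :=
  fun _ _ hij => h _ _ (hf hij)

theorem Bad.shift (h : D.Bad t) : D.Bad fun i => t (i + 1) :=
  fun _ _ hij => h _ _ (Nat.succ_lt_succ hij)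

/-- The picked element of `desc k t` is below no element of the descent of the shifted sequence at
level `k`, and the next level of the latter is such an element. -/
theorem Bad.not_le_desc (h : D.Bad t) (k : ℕ) :
    ¬ D.le (D.desc k t) (D.desc k fun i => t (i + 1)) := by
  induction k generalizing t with
  | zero => exact h 0 1 one_pos
  | succ k ih => exact (D.pick_spec (ih h)).2 _ (D.pick_spec (ih h.shift)).1

theorem Bad.desc_succ_mem (h : D.Bad t) (k : ℕ) : D.desc (k + 1) t ∈ D.elts (D.desc k t) :=
  (D.pick_spec (h.not_le_desc k)).1

theorem Bad.desc_eq_of_term (h : D.Bad t) {k l : ℕ} (hk : D.term (D.desc k t)) (hkl : k ≤ l) :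
    D.desc l t = D.desc k t := by
  induction l, hkl using Nat.le_induction with
  | base => rfl
  | succ l _ ih =>
    have h1 := h.desc_succ_mem l
    rwa [ih, D.elts_of_term _ hk] at h1

theorem Bad.exists_term (h : D.Bad t) : ∃ k, D.term (D.desc k t) := by
  by_contra! H
  obtain ⟨_, ⟨k, rfl⟩, hk⟩ := wellFounded_lt.has_min (Set.range fun k => D.rank (D.desc k t))
    ⟨_, 0, rfl⟩
  exact hk _ ⟨k + 1, rfl⟩ (D.rank_lt _ (H k) _ (h.desc_succ_mem k) (H (k + 1)))

variable (D) in
open Classical in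
/-- The length of the descent from `t`. -/
noncomputable def len (t : ℕ → V) : ℕ :=
  if h : ∃ k, D.term (D.desc k t) then Nat.find h else 0

variable (D) in
/-- The terminal element reached by the descent from `t`. -/
noncomputable def last (t : ℕ → V) : V := D.desc (D.len t) t

theorem Bad.term_last (h : D.Bad t) : D.term (D.last t) := by
  classical
  rw [last, len, dif_pos h.exists_term]
  exact Nat.find_spec h.exists_term

theorem not_term_of_lt_len {k : ℕ} (hk : k < D.len t) : ¬ D.term (D.desc k t) := by
  classical
  rw [len] at hk
  split_ifs at hk with h
  · exact Nat.find_min h hk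
  · exact (Nat.not_lt_zero k hk).elim

theorem Bad.desc_eq_last (h : D.Bad t) {k : ℕ} (hk : D.term (D.desc k t)) :
    D.desc k t = D.last t := by
  rcases le_total k (D.len t) with hle | hle
  · exact (h.desc_eq_of_term hk hle).symm
  · exact h.desc_eq_of_term h.term_last hle

theorem Bad.not_le_last (h : D.Bad t) : ¬ D.le (D.last t) (D.last fun i => t (i + 1)) := by
  have h1 := h.not_le_desc (max (D.len t) (D.len fun i => t (i + 1)))
  rwa [h.desc_eq_of_term h.term_last (le_max_left _ _),
    h.shift.desc_eq_of_term h.shift.term_last (le_max_right _ _)] at h1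

/-- `desc k` reads only the entries `0, …, k`, so the first `len + 1` entries determine where the
descent stops. This makes them the members of a front. -/
theorem Bad.len_congr (hs : D.Bad s) (ht : D.Bad t) (h : ∀ i ≤ D.len s, t i = s i) :
    D.len t = D.len s := by
  have h1 : ∀ k ≤ D.len s, D.desc k t = D.desc k s :=
    fun k hk => D.desc_congr fun i hi => h i (hi.trans hk)
  rcases lt_trichotomy (D.len t) (D.len s) with h2 | h2 | h2
  · exact (not_term_of_lt_len h2 (h1 _ h2.le ▸ ht.term_last)).elim
  · exact h2
  · refine (not_term_of_lt_len h2 ?_).elim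
    rw [h1 _ le_rfl]
    exact hs.term_last

theorem Bad.last_congr (hs : D.Bad s) (ht : D.Bad t) (h : ∀ i ≤ D.len s, t i = s i) :
    D.last t = D.last s := by
  rw [last, hs.len_congr ht h]
  exact D.desc_congr h

/-- The outcome of a descent is known once it is terminal, and the tree of non-terminal descents is
well-founded because `rank` decreases along it. -/
theorem Bad.barred {x : ℕ → V} (hx : D.Bad x) (s : ℕ → ℕ) :
    Barred (fun s => D.val (D.last (x ∘ s)) = none) 0 s := by
  set c : (ℕ → ℕ) → Prop := fun s => D.val (D.last (x ∘ s)) = none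
  have hterm : ∀ k s, StrictMono s → D.term (D.desc k (x ∘ s)) → Barred c (k + 1) s := by
    intro k s hs h
    refine .leaf fun t ht hts => ?_
    have h1 : D.desc k (x ∘ t) = D.desc k (x ∘ s) :=
      D.desc_congr fun i hi => congrArg x (hts i (by omega))
    have h2 : D.last (x ∘ t) = D.last (x ∘ s) := by
      rw [← (hx.comp hs).desc_eq_last h, ← (hx.comp ht).desc_eq_last (h1 ▸ h), h1]
    simp only [c, h2]
  have key : ∀ o : Ordinal.{v}, ∀ k s, StrictMono s → ¬ D.term (D.desc k (x ∘ s)) →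
      D.rank (D.desc k (x ∘ s)) = o → Barred c (k + 1) s := by
    intro o
    induction o using WellFoundedLT.induction with
    | ind o ih =>
      rintro k s hs hk rfl
      refine .node fun t ht hts => ?_
      by_cases h : D.term (D.desc (k + 1) (x ∘ t))
      · exact hterm _ t ht h
      · have h1 : D.desc k (x ∘ t) = D.desc k (x ∘ s) :=
          D.desc_congr fun i hi => congrArg x (hts i (by omega))
        refine ih _ (D.rank_lt _ hk _ ?_ h) (k + 1) t ht h rfl
        rw [← h1]
        exact (hx.comp ht).desc_succ_mem k
  refine .node fun t ht _ => ?_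
  by_cases h : D.term (D.desc 0 (x ∘ t))
  · exact hterm 0 t ht h
  · exact key _ 0 t ht h rfl

variable (D)

/-- By the partition theorem a bad sequence has a subsequence all of whose descents end with `val =
none`, or none of whose descents do. In the second case the final values form an array of rank `α`,
which must be good. -/
theorem wellQuasiOrdered (hP : IsOrdinalWqo P (α + 1)) : WellQuasiOrdered D.le := by
  intro x₀
  by_contra! H
  have hx₀ : D.Bad x₀ := H
  obtain ⟨B, -, hB, b, hb⟩ := (hx₀.barred id).exists_homogeneous Set.infinite_univ
  have hb' : ∀ t, StrictMono t → (∀ i, t i ∈ B) → (D.val (D.last (x₀ ∘ t)) = none ↔ b) :=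
    fun t ht h => hb t ht (fun i hi => (Nat.not_lt_zero i hi).elim) fun i _ => h i
  have he : StrictMono (Nat.nth (· ∈ B)) := Nat.nth_strictMono hB
  have heB : ∀ i, Nat.nth (· ∈ B) i ∈ B := Nat.nth_mem_of_infinite hB
  -- Otherwise the descents from the sequence and from its shift both end in valueless terminal
  -- elements, which are comparable.
  have hnb : ¬ b := by
    intro hb
    have h0 := hx₀.comp he
    exact h0.not_le_last <| D.le_of_none _ _ h0.term_last h0.shift.term_last
      ((hb' _ he heB).2 hb)
      ((hb' (fun i => Nat.nth (· ∈ B) (i + 1)) (fun i j hij => he (Nat.succ_lt_succ hij))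
        fun i => heB _).2 hb)
  set x := x₀ ∘ Nat.nth (· ∈ B) with hxdef
  have hx : D.Bad x := hx₀.comp he
  have hval : ∀ s, StrictMono s → ∃ p, D.val (D.last (x ∘ s)) = some p := fun s hs =>
    Option.ne_none_iff_exists'.1 fun h => hnb ((hb' _ (he.comp hs) fun i => heB (s i)).1 h)
  obtain ⟨F, hF, hrk⟩ := exists_front (fun s => D.len (x ∘ s))
    (fun s t hs ht h => (hx.comp hs).len_congr (hx.comp ht) fun i hi => congrArg x (h i hi))
    (fun k s => D.rank (D.desc k (x ∘ s))) (α := α)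
    (fun k s t h => congrArg D.rank (D.desc_congr fun i hi => congrArg x (h i hi)))
    (fun s hs k hk => D.rank_lt _ (not_term_of_lt_len (by omega)) _
      ((hx.comp hs).desc_succ_mem k) (not_term_of_lt_len hk))
    (fun s hs h => D.rank_lt_of_not_term _ (not_term_of_lt_len h))
  have hσ : ∀ σ : F.carrier, ∃ s, StrictMono s ∧ σ.1 = initVals s (D.len (x ∘ s) + 1) :=
    fun σ => hF.subset σ.2
  choose s hs hσs using hσ
  choose f hf using fun σ => hval (s σ) (hs σ)
  -- A good pair `σ ◁ τ` is realised by a sequence `r` and its shift; the values over `σ` and `τ`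
  -- are their final values, contradicting `Bad.not_le_last`.
  refine hP.2 F (hrk ▸ Order.lt_succ α) f fun σ τ hστ hle => ?_
  rw [hσs σ, hσs τ] at hστ
  obtain ⟨r, hr, h1, h2⟩ := exists_of_frontShift (hs σ) (hs τ) hστ
  have hr' : D.Bad (x ∘ r) := hx.comp hr
  refine hr'.not_le_last ?_
  rw [(hx.comp (hs σ)).last_congr hr' fun i hi => congrArg x (h1 i hi),
    (hx.comp (hs τ)).last_congr hr'.shift fun i hi => congrArg x (h2 i hi)]
  exact D.le_of_some _ _ (hx.comp (hs σ)).term_last (hx.comp (hs τ)).term_last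
    _ (hf σ) _ (hf τ) hle

end Descent

/-! ## The hierarchy of letters -/

section Letters

variable {P : Type u} [Preorder P] {α β : Ordinal.{u}} {x y z : HSet (FreeMonoid P)}

variable (P) in
/-- The letters of stage `α` as a set of iterated ideals. -/
def letterSet (α : Ordinal.{u}) : Set (HSet (FreeMonoid P)) :=
  letterIdeals P α ∪ starIdeals P α

/-- Merges the three clauses of the recursion into one, so that later proofs can use well-founded
induction without distinguishing limits. -/
theorem mem_starIdeals : z ∈ starIdeals P α ↔ ∃ β < α, ∃ X ∈ downSets (letterSet P β),
    z.IsSet ∧ ∀ w, w ∈ z ↔ w ∈ Submonoid.closure X := by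
  induction α using Ordinal.limitRecOn with
  | zero =>
    rw [starIdeals, Ordinal.limitRecOn_zero]
    simp
  | add_one α ih =>
    have hsucc : starIdeals P (α + 1) = starIdeals P α ∪
        {z | ∃ X ∈ downSets (starIdeals P α ∪ letterIdeals P α),
          z.IsSet ∧ ∀ w, w ∈ z ↔ w ∈ Submonoid.closure X} := by
      rw [starIdeals, Ordinal.limitRecOn_add_one]
      rfl
    rw [hsucc, Set.mem_union, ih, Set.union_comm (starIdeals P α) (letterIdeals P α)]
    constructor
    · rintro (⟨β, hβ, h⟩ | h)
      · exact ⟨β, hβ.trans (Order.lt_succ α), h⟩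
      · exact ⟨α, Order.lt_succ α, h⟩
    · rintro ⟨β, hβ, h⟩
      rcases (Order.lt_succ_iff.1 hβ).lt_or_eq with hβ | rfl
      · exact .inl ⟨β, hβ, h⟩
      · exact .inr ‹_›
  | limit α hα ih =>
    have h : starIdeals P α = ⋃ (β : Ordinal.{u}) (_ : β < α), starIdeals P β := by
      rw [starIdeals, Ordinal.limitRecOn_limit _ _ _ _ hα]
      rfl
    simp only [h, Set.mem_iUnion]
    constructor
    · rintro ⟨β, hβ, h⟩
      obtain ⟨γ, hγ, h⟩ := (ih β hβ).1 h
      exact ⟨γ, hγ.trans hβ, h⟩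
    · rintro ⟨β, hβ, h⟩
      exact ⟨_, hα.succ_lt hβ, (ih _ (hα.succ_lt hβ)).2 ⟨β, Order.lt_succ β, h⟩⟩

theorem letterIdeals_mono (h : α ≤ β) : letterIdeals P α ⊆ letterIdeals P β :=
  fun _ hx => IterIdeal.mono hx h

theorem starIdeals_mono (h : α ≤ β) : starIdeals P α ⊆ starIdeals P β := by
  intro x hx
  rw [mem_starIdeals] at hx ⊢
  exact hx.imp fun γ hγ => ⟨hγ.1.trans_le h, hγ.2⟩

theorem letterSet_mono (h : α ≤ β) : letterSet P α ⊆ letterSet P β :=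
  Set.union_subset_union (letterIdeals_mono h) (starIdeals_mono h)

theorem isLetterIdeal_of_mem (h : x ∈ letterIdeals P α) : x.IsLetterIdeal := ⟨α, h⟩

theorem one_le_of_iterIdeal (h : IterIdeal Set.univ α x) : 1 ≤ x := by
  simpa using IterIdeal.le_mul h 1

theorem le_mul_of_iterIdeal_left (h : IterIdeal Set.univ α x) : y ≤ x * y := by
  simpa using HSet.mul_le_mul_right' y (one_le_of_iterIdeal h)

theorem HSet.mul_le_mul'' {a b c d : HSet (FreeMonoid P)} (h : a ≤ b) (h' : c ≤ d) :
    a * c ≤ b * d :=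
  (HSet.mul_le_mul_right' c h).trans (HSet.mul_le_mul_left' b h')

/-- A submonoid of iterated ideals is directed because `u` and `v` both lie below `u * v`. -/
theorem iterIdeal_of_isSet_closure {X : Set (HSet (FreeMonoid P))} (hβ : β < α)
    (hX : ∀ x ∈ X, IterIdeal Set.univ β x) (hz : z.IsSet)
    (h : ∀ w, w ∈ z ↔ w ∈ Submonoid.closure X) : IterIdeal Set.univ α z := by
  have hle : Submonoid.closure X ≤ iterIdealMonoid (FreeMonoid P) β :=
    Submonoid.closure_le.2 hX
  refine .set hβ hz ⟨1, (h 1).2 (one_mem _)⟩ (fun y hy => hle ((h y).1 hy)) fun u hu v hv => ?_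
  have hu' := (h u).1 hu
  have hv' := (h v).1 hv
  exact ⟨u * v, (h _).2 (mul_mem hu' hv'), IterIdeal.le_mul (hle hv') u,
    le_mul_of_iterIdeal_left (hle hu')⟩

/-! ### The position of letters with respect to `1` and to each other -/

theorem iterIdeal_of_mem_letterSet (h : x ∈ letterSet P α) : IterIdeal Set.univ α x := by
  induction α using WellFoundedLT.induction generalizing x with
  | ind α ih =>
    rcases h with h | h
    · exact IterIdeal.mono_set h (Set.subset_univ _)
    · obtain ⟨β, hβ, X, hX, hz, h⟩ := mem_starIdeals.1 h
      exact iterIdeal_of_isSet_closure hβ (fun y hy => ih β hβ (hX.2.1 hy)) hz h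

theorem not_le_one_of_mem_letterSet (h : x ∈ letterSet P α) : ¬ x ≤ 1 := by
  induction α using WellFoundedLT.induction generalizing x with
  | ind α ih =>
    rcases h with h | h
    · exact (isLetterIdeal_of_mem h).not_le_one
    · obtain ⟨β, hβ, X, ⟨⟨y, hy⟩, hX, -⟩, hz, h⟩ := mem_starIdeals.1 h
      exact fun hle => ih β hβ (hX hy) ((HSet.le_of_mem_els
        ((HSet.mem_els_of_isSet hz).2 ((h y).2 (Submonoid.subset_closure hy)))).trans hle)

/-- `x` contains a square `w * w` with `w ≰ 1`, whereas an iterated ideal over `P` lies above no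
product of two factors that are both `≰ 1`. -/
theorem not_le_of_mem_starIdeals (hx : x ∈ starIdeals P α) (hy : y.IsLetterIdeal) : ¬ x ≤ y := by
  intro hle
  obtain ⟨β, hβ, X, ⟨⟨w, hw⟩, hX, -⟩, hz, h⟩ := mem_starIdeals.1 hx
  have hw' := Submonoid.subset_closure hw
  obtain ⟨y', hy', hle'⟩ := HSet.le_iff_els.1 hle (w * w)
    ((HSet.mem_els_of_isSet hz).2 ((h _).2 (mul_mem hw' hw')))
  rcases (hy.of_mem_els hy').le_one_or_le_one hle' with h | h <;>
  exact not_le_one_of_mem_letterSet (hX hw) h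

theorem not_isLetterIdeal_of_mem (hx : x ∈ starIdeals P α) : ¬ x.IsLetterIdeal :=
  fun h => not_le_of_mem_starIdeals hx h le_rfl

theorem isSet_of_mem_starIdeals (hx : x ∈ starIdeals P α) : x.IsSet := by
  obtain ⟨β, hβ, X, hX, hz, h⟩ := mem_starIdeals.1 hx
  exact hz

theorem mul_self_le_of_mem_starIdeals (hx : x ∈ starIdeals P α) : x * x ≤ x := by
  obtain ⟨β, hβ, X, hX, hz, h⟩ := mem_starIdeals.1 hx
  rw [HSet.le_iff_els, HSet.els_mul]
  rintro _ ⟨u, hu, v, hv, rfl⟩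
  simp only [HSet.mem_els_of_isSet hz, h] at hu hv ⊢
  exact ⟨u * v, mul_mem hu hv, le_rfl⟩

/-- Stars can be compared through generators. This matters for the descent, since general elements
of a star are products rather than letters. -/
theorem le_of_forall_exists_le {X Y : Set (HSet (FreeMonoid P))} (hx : x.IsSet) (hy : y.IsSet)
    (hX : ∀ w, w ∈ x ↔ w ∈ Submonoid.closure X) (hY : ∀ w, w ∈ y ↔ w ∈ Submonoid.closure Y)
    (h : ∀ x' ∈ X, ∃ y' ∈ Y, x' ≤ y') : x ≤ y := by
  rw [HSet.le_iff_els]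
  simp only [HSet.mem_els_of_isSet hx, HSet.mem_els_of_isSet hy, hX, hY]
  intro w hw
  induction hw using Submonoid.closure_induction with
  | mem w hw =>
    obtain ⟨y', hy', hle⟩ := h w hw
    exact ⟨y', Submonoid.subset_closure hy', hle⟩
  | one => exact ⟨1, one_mem _, le_rfl⟩
  | mul u v _ _ ihu ihv =>
    obtain ⟨u', hu', hu⟩ := ihu
    obtain ⟨v', hv', hv⟩ := ihv
    exact ⟨u' * v', mul_mem hu' hv', HSet.mul_le_mul'' hu hv⟩

/-- No set enters the hierarchy at stage `0` or at a limit stage. Hence `letterRank` records the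
predecessor `γ` of the first stage containing a set `x`, and its elements or generators can be found
in stage `γ`. -/
theorem exists_mem_letterSet_succ (h : x ∈ letterSet P α) (hx : x.IsSet) :
    ∃ γ < α, x ∈ letterSet P (γ + 1) := by
  rcases h with h | h
  · cases (h : IterIdeal _ _ _) with
    | ur hq => exact (HSet.not_isSet_ur _ hx).elim
    | @set _ β _ hβ hx hne hmem hdir =>
      exact ⟨β, hβ, .inl (.set (Order.lt_succ β) hx hne hmem hdir)⟩
  · obtain ⟨β, hβ, h⟩ := mem_starIdeals.1 h
    exact ⟨β, hβ, .inr (mem_starIdeals.2 ⟨β, Order.lt_succ β, h⟩)⟩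

/-- The stage at which a letter is formed. -/
noncomputable def letterRank (x : HSet (FreeMonoid P)) : Ordinal.{u} :=
  sInf {γ | x ∈ letterSet P (γ + 1)}

theorem letterRank_lt (h : x ∈ letterSet P α) (hx : x.IsSet) : letterRank x < α := by
  obtain ⟨γ, hγ, h⟩ := exists_mem_letterSet_succ h hx
  exact (csInf_le' (show γ ∈ {γ | x ∈ letterSet P (γ + 1)} from h)).trans_lt hγ

theorem mem_letterSet_letterRank (h : x ∈ letterSet P α) (hx : x.IsSet) :
    x ∈ letterSet P (letterRank x + 1) := by
  obtain ⟨γ, hγ, h⟩ := exists_mem_letterSet_succ h hx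
  exact csInf_mem (s := {γ | x ∈ letterSet P (γ + 1)}) ⟨γ, h⟩

theorem mem_letterSet_of_mem (h : x ∈ letterSet P α) (hx : x.IsSet) (hI : x ∉ starIdeals P α)
    (hy : y ∈ x) : y ∈ letterSet P (letterRank x) := by
  have hI' : x.IsLetterIdeal := isLetterIdeal_of_mem (h.resolve_right hI)
  have h1 := (mem_letterSet_letterRank h hx).resolve_right fun h => not_isLetterIdeal_of_mem h hI'
  obtain ⟨β, hβ, h2⟩ := IterIdeal.exists_lt_of_isSet h1 hx
  exact .inl ((h2 y hy).mono (Order.lt_succ_iff.1 hβ))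

/-- The generators take the place of the elements in the descent: they are letters of an earlier
stage. -/
theorem exists_generators (h : x ∈ starIdeals P α) : ∃ X : Set (HSet (FreeMonoid P)),
    X.Nonempty ∧ X ⊆ letterSet P (letterRank x) ∧ ∀ w, w ∈ x ↔ w ∈ Submonoid.closure X := by
  have h1 := (mem_letterSet_letterRank (.inr h) (isSet_of_mem_starIdeals h)).resolve_left
    fun h' => not_isLetterIdeal_of_mem h (isLetterIdeal_of_mem h')
  obtain ⟨β, hβ, X, hX, -, h2⟩ := mem_starIdeals.1 h1
  exact ⟨X, hX.1, hX.2.1.trans (letterSet_mono (Order.lt_succ_iff.1 hβ)), h2⟩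

theorem ur_mem_letterIdeals (p : P) : HSet.ur (FreeMonoid.of p) ∈ letterIdeals P α :=
  IterIdeal.ur ⟨p, rfl⟩

/-- The letters over an `(α + 1)`-wqo form a wqo. -/
theorem wellQuasiOrdered_letters (hP : IsOrdinalWqo P (α + 1)) :
    WellQuasiOrdered fun x y : Letters P α => x ≤ y := by
  classical
  have hgen : ∀ x : Letters P α, ∃ X : Set (HSet (FreeMonoid P)), x.1 ∈ starIdeals P α →
      X.Nonempty ∧ X ⊆ letterSet P (letterRank x.1) ∧ ∀ w, w ∈ x.1 ↔ w ∈ Submonoid.closure X := by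
    intro x
    by_cases h : x.1 ∈ starIdeals P α
    · exact (exists_generators h).imp fun X hX _ => hX
    · exact ⟨∅, fun h' => (h h').elim⟩
  choose X hX using hgen
  have hI : ∀ x : Letters P α, x.1 ∉ starIdeals P α → x.1.IsLetterIdeal :=
    fun x hx => isLetterIdeal_of_mem (x.2.resolve_right hx)
  have hnI : ∀ x : HSet (FreeMonoid P), x.IsLetterIdeal → x ∉ starIdeals P α :=
    fun x hx h => not_isLetterIdeal_of_mem h hx
  have hXmem : ∀ x : Letters P α, x.1 ∈ starIdeals P α → ∀ y ∈ X x, y ∈ letterSet P α :=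
    fun x hx y hy => letterSet_mono (letterRank_lt x.2 (isSet_of_mem_starIdeals hx)).le
      ((hX x hx).2.1 hy)
  have hels : ∀ x : Letters P α, x.1 ∉ starIdeals P α → ∀ y ∈ x.1.els, y ∈ letterSet P α :=
    fun x hx y hy => .inl (IterIdeal.of_mem_els (x.2.resolve_right hx) hy)
  have hXels : ∀ x : Letters P α, x.1 ∈ starIdeals P α → ∀ y ∈ X x, y ∈ x.1.els :=
    fun x hx y hy => (HSet.mem_els_of_isSet (isSet_of_mem_starIdeals hx)).2
      (((hX x hx).2.2 y).2 (Submonoid.subset_closure hy))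
  -- The extra point `none` marks stars: it counts as an element of every star and of no other
  -- letter. It is needed because a star `x` is never below an iterated ideal `y` over `P`, even if
  -- each generator of `x` is below some element of `y`; then `none` witnesses the failure. It is
  -- terminal without a value, while urelements carry their value in `P`.
  let D : Descent (Option (Letters P α)) P α :=
    { le := fun v w => match v, w with
        | none, none => True
        | none, some y => y.1 ∈ starIdeals P α
        | some _, none => False
        | some x, some y => x ≤ y
      elts := fun v => match v with
        | none => {none}
        | some x => {w | (x.1 ∈ starIdeals P α ∧ w = none) ∨ ∃ y, w = some y ∧
            (x.1 ∈ starIdeals P α ∧ y.1 ∈ X x ∨ x.1 ∉ starIdeals P α ∧ y.1 ∈ x.1.els)}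
      term := fun v => match v with
        | none => True
        | some x => ¬ x.1.IsSet
      val := fun v => match v with
        | none => none
        | some x => if h : ∃ p, x.1 = HSet.ur (FreeMonoid.of p) then some h.choose else none
      rank := fun v => match v with
        | none => 0
        | some x => letterRank x.1
      exists_elts := by
        rintro (_ | x) (_ | y) h
        · exact (h trivial).elim
        · refine ⟨none, rfl, ?_⟩
          rintro _ (⟨hy, -⟩ | ⟨y', rfl, ⟨hy, -⟩ | ⟨hy, hy'⟩⟩)
          · exact (h hy).elim
          · exact (h hy).elim
          · exact hnI _ ((hI y hy).of_mem_els hy')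
        · by_cases hx : x.1 ∈ starIdeals P α
          · obtain ⟨x', hx'⟩ := (hX x hx).1
            refine ⟨some ⟨x', hXmem x hx x' hx'⟩, .inr ⟨_, rfl, .inl ⟨hx, hx'⟩⟩, ?_⟩
            rintro _ rfl
            exact id
          · obtain ⟨x', hx'⟩ := (hI x hx).choose_spec.els_nonempty
            refine ⟨some ⟨x', hels x hx x' hx'⟩, .inr ⟨_, rfl, .inr ⟨hx, hx'⟩⟩, ?_⟩
            rintro _ rfl
            exact id
        · by_cases hx : x.1 ∈ starIdeals P α
          · by_cases hy : y.1 ∈ starIdeals P α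
            · have h1 : ∃ x' ∈ X x, ∀ y' ∈ X y, ¬ x' ≤ y' := by
                by_contra! H
                exact h (le_of_forall_exists_le (isSet_of_mem_starIdeals hx)
                  (isSet_of_mem_starIdeals hy) (hX x hx).2.2 (hX y hy).2.2 H)
              obtain ⟨x', hx', h1⟩ := h1
              refine ⟨some ⟨x', hXmem x hx x' hx'⟩, .inr ⟨_, rfl, .inl ⟨hx, hx'⟩⟩, ?_⟩
              rintro _ (⟨-, rfl⟩ | ⟨y', rfl, ⟨-, hy'⟩ | ⟨hy', -⟩⟩)
              · exact id
              · exact h1 y'.1 hy'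
              · exact (hy' hy).elim
            · refine ⟨none, .inl ⟨hx, rfl⟩, ?_⟩
              rintro _ (⟨hy', -⟩ | ⟨y', rfl, ⟨hy', -⟩ | ⟨-, hy'⟩⟩)
              · exact (hy hy').elim
              · exact (hy hy').elim
              · exact hnI _ ((hI y hy).of_mem_els hy')
          · obtain ⟨x', hx', h1⟩ := HSet.not_le_iff_els.1 (show ¬ x.1 ≤ y.1 from h)
            refine ⟨some ⟨x', hels x hx x' hx'⟩, .inr ⟨_, rfl, .inr ⟨hx, hx'⟩⟩, ?_⟩
            rintro _ (⟨-, rfl⟩ | ⟨y', rfl, ⟨hy, hy'⟩ | ⟨-, hy'⟩⟩)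
            · exact id
            · exact h1 y'.1 (hXels y hy y'.1 hy')
            · exact h1 y'.1 hy'
      elts_of_term := by
        rintro (_ | x) h
        · rfl
        · have hx : x.1 ∉ starIdeals P α := fun hx => h (isSet_of_mem_starIdeals hx)
          obtain ⟨q, hq⟩ := (HSet.isSet_or_ur x.1).resolve_left h
          ext w
          constructor
          · rintro (⟨hx', -⟩ | ⟨y, rfl, ⟨hx', -⟩ | ⟨-, hy⟩⟩)
            · exact (hx hx').elim
            · exact (hx hx').elim
            · rw [hq, HSet.els_ur, ← hq] at hy
              exact congrArg some (Subtype.ext hy)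
          · rintro rfl
            refine .inr ⟨x, rfl, .inr ⟨hx, ?_⟩⟩
            rw [hq, HSet.els_ur]
            rfl
      rank_lt := by
        rintro (_ | x) h v' hv' h'
        · exact (h trivial).elim
        · rw [not_not] at h
          obtain ⟨-, rfl⟩ | ⟨y, rfl, hy⟩ := hv'
          · exact (h' trivial).elim
          · rw [not_not] at h'
            refine letterRank_lt ?_ h'
            rcases hy with ⟨hx, hy⟩ | ⟨hx, hy⟩
            · exact (hX x hx).2.1 hy
            · exact mem_letterSet_of_mem x.2 h hx ((HSet.mem_els_of_isSet h).1 hy)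
      rank_lt_of_not_term := by
        rintro (_ | x) h
        · exact (h trivial).elim
        · exact letterRank_lt x.2 (not_not.1 h)
      le_of_none := by
        have key : ∀ x : Letters P α, ¬ x.1.IsSet →
            (if h : ∃ p, x.1 = HSet.ur (FreeMonoid.of p) then some h.choose else none) ≠ none := by
          intro x hx
          obtain ⟨q, hq⟩ := (HSet.isSet_or_ur x.1).resolve_left hx
          have h1 := hI x fun hx' => hx (isSet_of_mem_starIdeals hx')
          rw [hq] at h1
          obtain ⟨p, rfl⟩ := h1.exists_of
          rw [dif_pos ⟨p, hq⟩]
          exact Option.some_ne_none _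
        rintro (_ | x) (_ | y) hv hw h h'
        · trivial
        · exact (key y hw h').elim
        · exact (key x hv h).elim
        · exact (key x hv h).elim
      le_of_some := by
        have key : ∀ x : Letters P α, ∀ p ∈
            (if h : ∃ p, x.1 = HSet.ur (FreeMonoid.of p) then some h.choose else none),
            x.1 = HSet.ur (FreeMonoid.of p) := by
          intro x p hp
          split_ifs at hp with h
          · rw [← Option.mem_some_iff.1 hp]
            exact h.choose_spec
          · cases hp
        rintro (_ | x) (_ | y) hv hw p hp q hq hpq
        · cases hp
        · cases hp
        · cases hq
        · change x.1 ≤ y.1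
          rw [key x p hp, key y q hq]
          exact HSet.ur_le_ur.2 (.cons hpq .nil) }
  exact fun f => D.wellQuasiOrdered hP fun n => some (f n)

end Letters

/-! ## Ideals of words in the generalized Higman ordering -/

/-- Points `x n ∈ D n \ D (n + 1)` of a descending chain form a bad sequence. -/
theorem WellQuasiOrdered.wellFoundedLT_lowerSet {L : Type u} [Preorder L]
    (h : WellQuasiOrdered fun x y : L => x ≤ y) : WellFoundedLT (LowerSet L) := by
  refine ⟨RelEmbedding.wellFounded_iff_isEmpty.2 ⟨fun D => ?_⟩⟩
  have hD : ∀ m n, m < n → D n < D m := fun m n hmn => D.map_rel_iff.2 hmn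
  have hex : ∀ n, ∃ x ∈ D n, x ∉ D (n + 1) := fun n =>
    Set.not_subset.1 (hD n (n + 1) n.lt_succ_self).not_ge
  choose x hx hx' using hex
  obtain ⟨m, n, hmn, hle⟩ := h x
  refine hx' m ((D (m + 1)).lower hle ?_)
  rcases (Nat.succ_le_of_lt hmn).eq_or_lt with he | hlt
  · exact (show m + 1 = n from he) ▸ hx n
  · exact (hD _ _ hlt).le (hx n)

theorem LowerSet.mem_erase_iff {L : Type u} [Preorder L] {X : LowerSet L} {a x : L} :
    x ∈ X.erase a ↔ x ∈ X ∧ ¬ a ≤ x := by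
  rw [← SetLike.mem_coe, LowerSet.coe_erase]
  simp

/-- Every lower set is a finite union of ideals if the lower sets satisfy the descending chain
condition. -/
theorem LowerSet.exists_finite_ideals {L : Type u} [Preorder L] [WellFoundedLT (LowerSet L)]
    (D : LowerSet L) : ∃ 𝒥 : Set (LowerSet L), 𝒥.Finite ∧
      (∀ J ∈ 𝒥, J ≤ D ∧ (J : Set L).Nonempty ∧ DirectedOn (· ≤ ·) (J : Set L)) ∧
      ∀ x ∈ D, ∃ J ∈ 𝒥, x ∈ J := by
  induction D using WellFoundedLT.induction with
  | ind D ih =>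
    by_cases hne : (D : Set L).Nonempty
    · by_cases hd : DirectedOn (· ≤ ·) (D : Set L)
      · exact ⟨{D}, Set.finite_singleton D, by
          rintro J rfl
          exact ⟨le_rfl, hne, hd⟩, by simp⟩
      · have hd' : ∃ a ∈ D, ∃ b ∈ D, ∀ c ∈ D, a ≤ c → ¬ b ≤ c := by
          simpa [DirectedOn] using hd
        obtain ⟨a, ha, b, hb, hab⟩ := hd'
        -- As `a` and `b` have no common upper bound in `D`, each point of `D` fails to be above one
        -- of them, so the two smaller lower sets cover `D`.
        obtain ⟨𝒥₁, hf₁, h₁, hc₁⟩ := ih _ (LowerSet.erase_lt.2 ha)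
        obtain ⟨𝒥₂, hf₂, h₂, hc₂⟩ := ih _ (LowerSet.erase_lt.2 hb)
        refine ⟨𝒥₁ ∪ 𝒥₂, hf₁.union hf₂, ?_, fun x hx => ?_⟩
        · rintro J (hJ | hJ)
          · exact ⟨(h₁ J hJ).1.trans (LowerSet.erase_lt.2 ha).le, (h₁ J hJ).2⟩
          · exact ⟨(h₂ J hJ).1.trans (LowerSet.erase_lt.2 hb).le, (h₂ J hJ).2⟩
        · by_cases hax : a ≤ x
          · obtain ⟨J, hJ, hxJ⟩ := hc₂ x (LowerSet.mem_erase_iff.2 ⟨hx, hab x hx hax⟩)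
            exact ⟨J, .inr hJ, hxJ⟩
          · obtain ⟨J, hJ, hxJ⟩ := hc₁ x (LowerSet.mem_erase_iff.2 ⟨hx, hax⟩)
            exact ⟨J, .inl hJ, hxJ⟩
    · exact ⟨∅, Set.finite_empty, by simp, fun x hx => (hne ⟨x, hx⟩).elim⟩

theorem List.exists_eq_append_cons_of_exists {L : Type u} {p : L → Prop} {u : List L} (h : ∃ x ∈ u, p x) :
    ∃ u₁ x u₂, u = u₁ ++ x :: u₂ ∧ p x ∧ ∀ y ∈ u₁, ¬ p y := by
  induction u with
  | nil => simp at h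
  | cons a u ih =>
    by_cases ha : p a
    · exact ⟨[], a, u, rfl, ha, by simp⟩
    · obtain ⟨u₁, x, u₂, rfl, hx, hu⟩ := ih (by simpa [ha] using h)
      exact ⟨a :: u₁, x, u₂, rfl, hx, by simpa [ha] using hu⟩

namespace HigmanRel

variable {L : Type u} [Preorder L] {Li : Set L}

theorem exists_append {u v₁ v₂ : List L} (h : HigmanRel Li u (v₁ ++ v₂)) :
    ∃ u₁ u₂, u = u₁ ++ u₂ ∧ HigmanRel Li u₁ v₁ ∧ HigmanRel Li u₂ v₂ := by
  generalize hv : v₁ ++ v₂ = v at h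
  induction h generalizing v₁ with
  | nil v => exact ⟨[], [], rfl, .nil _, .nil _⟩
  | skip y h ih =>
    rcases v₁ with _ | ⟨y', v₁⟩
    · exact ⟨[], _, rfl, .nil _, by
        rw [List.nil_append] at hv
        exact hv ▸ .skip y h⟩
    · obtain ⟨rfl, hv'⟩ := List.cons.inj hv
      obtain ⟨u₁, u₂, rfl, h₁, h₂⟩ := ih hv'
      exact ⟨u₁, u₂, rfl, .skip _ h₁, h₂⟩
  | one hxy h ih =>
    rcases v₁ with _ | ⟨y', v₁⟩
    · exact ⟨[], _, rfl, .nil _, by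
        rw [List.nil_append] at hv
        exact hv ▸ .one hxy h⟩
    · obtain ⟨rfl, hv'⟩ := List.cons.inj hv
      obtain ⟨u₁, u₂, rfl, h₁, h₂⟩ := ih hv'
      exact ⟨_ :: u₁, u₂, rfl, .one hxy h₁, h₂⟩
  | many hxy hy h ih =>
    rcases v₁ with _ | ⟨y', v₁⟩
    · exact ⟨[], _, rfl, .nil _, by
        rw [List.nil_append] at hv
        exact hv ▸ .many hxy hy h⟩
    · obtain ⟨rfl, -⟩ := List.cons.inj hv
      obtain ⟨u₁, u₂, rfl, h₁, h₂⟩ := ih hv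
      exact ⟨_ :: u₁, u₂, rfl, .many hxy hy h₁, h₂⟩

theorem append {u u' v v' : List L} (h : HigmanRel Li u u') (h' : HigmanRel Li v v') :
    HigmanRel Li (u ++ v) (u' ++ v') := (GenHigman.Le.append (.of_rel h) (.of_rel h')).rel

theorem exists_le_of_mem {u v : List L} (h : HigmanRel Li u v) {x : L} (hx : x ∈ u) :
    ∃ y ∈ v, x ≤ y := by
  induction h with
  | nil v => simp at hx
  | skip y h ih =>
    obtain ⟨z, hz, hle⟩ := ih hx
    exact ⟨z, List.mem_cons_of_mem _ hz, hle⟩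
  | one hxy h ih =>
    rcases List.mem_cons.1 hx with rfl | hx
    · exact ⟨_, List.mem_cons_self, hxy⟩
    · obtain ⟨z, hz, hle⟩ := ih hx
      exact ⟨z, List.mem_cons_of_mem _ hz, hle⟩
  | many hxy hy h ih =>
    rcases List.mem_cons.1 hx with rfl | hx
    · exact ⟨_, List.mem_cons_self, hxy⟩
    · exact ih hx

theorem of_forall_le {u : List L} {y : L} (hy : y ∈ Li) (h : ∀ x ∈ u, x ≤ y) :
    HigmanRel Li u [y] := by
  induction u with
  | nil => exact .nil _
  | cons x u ih =>
    exact .many (h x List.mem_cons_self) hy (ih fun z hz => h z (List.mem_cons_of_mem _ hz))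

end HigmanRel

/-- The atoms from which the ideals of words are built: a lower set `J` of letters stands for the
words of length at most one over `J` (first summand) or for all words over `J` (second summand). -/
abbrev WordAtom (L : Type u) [Preorder L] : Type u := LowerSet L ⊕ LowerSet L

namespace WordAtom

variable {L : Type u} [Preorder L] {Li : Set L}

/-- The words described by an atom. -/
def Mem : WordAtom L → List L → Prop
  | .inl J, u => u = [] ∨ ∃ j ∈ J, u = [j]
  | .inr X, u => ∀ l ∈ u, l ∈ X

/-- The products of words described by a list of atoms. -/
def ListMem : List (WordAtom L) → List L → Prop
  | [], u => u = []
  | C :: Cs, u => ∃ u₁ u₂, u = u₁ ++ u₂ ∧ Mem C u₁ ∧ ListMem Cs u₂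

/-- The atoms of the first kind that are admitted are the ideals of letters outside `Li`. -/
def Valid (Li : Set L) : WordAtom L → Prop
  | .inl J => (J : Set L).Nonempty ∧ DirectedOn (· ≤ ·) (J : Set L) ∧ ∀ j ∈ J, j ∉ Li
  | .inr _ => True

/-- The well-founded order of atoms. -/
def Lt : WordAtom L → WordAtom L → Prop := Sum.Lex (· < ·) (· < ·)

theorem listMem_append {Cs Ds : List (WordAtom L)} {u₁ u₂ : List L} (h₁ : ListMem Cs u₁)
    (h₂ : ListMem Ds u₂) : ListMem (Cs ++ Ds) (u₁ ++ u₂) := by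
  induction Cs generalizing u₁ with
  | nil =>
    rw [show u₁ = [] from h₁]
    exact h₂
  | cons C Cs ih =>
    obtain ⟨v₁, v₂, rfl, hv₁, hv₂⟩ := h₁
    exact ⟨v₁, v₂ ++ u₂, by simp, hv₁, ih hv₂⟩

/-- Atoms are downward closed. Validity is needed for the first kind: a letter from `Li` would have
words of any length below it. -/
theorem Mem.of_rel {C : WordAtom L} (hC : Valid Li C) {u v : List L} (hv : Mem C v)
    (h : HigmanRel Li u v) : Mem C u := by
  rcases C with J | X
  · rcases hv with rfl | ⟨j, hj, rfl⟩
    · cases h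
      exact .inl rfl
    · cases h with
      | nil => exact .inl rfl
      | skip _ h =>
        cases h
        exact .inl rfl
      | one hxy h =>
        cases h
        exact .inr ⟨_, J.lower hxy hj, rfl⟩
      | many hxy hy h => exact (hC.2.2 j hj hy).elim
  · intro l hl
    obtain ⟨y, hy, hle⟩ := h.exists_le_of_mem hl
    exact X.lower hle (hv y hy)

theorem ListMem.of_rel {Cs : List (WordAtom L)} (hC : ∀ C ∈ Cs, Valid Li C) {u v : List L}
    (hv : ListMem Cs v) (h : HigmanRel Li u v) : ListMem Cs u := by
  induction Cs generalizing u v with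
  | nil =>
    rw [show v = [] from hv] at h
    cases h
    rfl
  | cons C Cs ih =>
    obtain ⟨v₁, v₂, rfl, hv₁, hv₂⟩ := hv
    obtain ⟨u₁, u₂, rfl, h₁, h₂⟩ := h.exists_append
    exact ⟨u₁, u₂, rfl, hv₁.of_rel (hC C List.mem_cons_self) h₁,
      ih (fun D hD => hC D (List.mem_cons_of_mem _ hD)) hv₂ h₂⟩

variable [WellFoundedLT (LowerSet L)]

/-- The words over `X` that are not above `w` are covered by finitely many products of atoms that
precede the atom of all words over `X`. -/
theorem exists_cover_star (hLi : IsUpperSet Li) (X : LowerSet L) {w : List L}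
    (hw : ∀ l ∈ w, l ∈ X) : ∃ 𝒟 : Set (List (WordAtom L)), 𝒟.Finite ∧
      (∀ Cs ∈ 𝒟, ∀ C ∈ Cs, Lt C (.inr X) ∧ Valid Li C) ∧
      ∀ z : List L, (∀ l ∈ z, l ∈ X) → ¬ HigmanRel Li w z → ∃ Cs ∈ 𝒟, ListMem Cs z := by
  induction w with
  | nil => exact ⟨∅, Set.finite_empty, by simp, fun z _ h => (h (.nil z)).elim⟩
  | cons l w ih =>
    -- A word `z` not above `l :: w` either has no letter above `l`, or is `z₁ ++ x :: z₂` with `x`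
    -- the first such letter. Then `z₁` is a word over `X.erase l`, and `z₂` is not above `w`, so
    -- that the cover for `w` applies to it. It remains to place `x`.
    obtain ⟨𝒟, hf, hlt, hcov⟩ := ih fun l hl => hw l (List.mem_cons_of_mem _ hl)
    obtain ⟨𝒥, hfJ, hJ, hcovJ⟩ := LowerSet.exists_finite_ideals (X ⊓ ⟨Liᶜ, hLi.compl⟩)
    have herase : ∀ l' ∈ l :: w, Lt (.inr (X.erase l')) (.inr X : WordAtom L) ∧
        Valid Li (.inr (X.erase l')) :=
      fun l' hl' => ⟨Sum.Lex.inr (LowerSet.erase_lt.2 (hw l' hl')), trivial⟩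
    have hl : l ∈ l :: w := List.mem_cons_self
    refine ⟨{[.inr (X.erase l)]} ∪
      (Set.image2 (fun J Cs => .inr (X.erase l) :: .inl J :: Cs) 𝒥 𝒟 ∪
      Set.image2 (fun l' Cs => .inr (X.erase l) :: .inr (X.erase l') :: Cs) {l' | l' ∈ l :: w} 𝒟),
      (Set.finite_singleton _).union ((hfJ.image2 _ hf).union
        ((List.finite_toSet (l :: w)).image2 _ hf)), ?_, fun z hz hnle => ?_⟩
    · rintro _ (rfl | ⟨J, hJ', Cs, hCs, rfl⟩ | ⟨l', hl', Cs, hCs, rfl⟩) C hC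
      · rw [List.mem_singleton.1 hC]
        exact herase l hl
      · rcases List.mem_cons.1 hC with rfl | hC
        · exact herase l hl
        · rcases List.mem_cons.1 hC with rfl | hC
          -- Every atom of the first kind precedes every atom of the second kind, whatever the sizes
          -- of `J` and `X`.
          · exact ⟨Sum.Lex.sep _ _, (hJ J hJ').2.1, (hJ J hJ').2.2,
              fun j hj => ((hJ J hJ').1 hj).2⟩
          · exact hlt Cs hCs C hC
      · rcases List.mem_cons.1 hC with rfl | hC
        · exact herase l hl
        · rcases List.mem_cons.1 hC with rfl | hC
          · exact herase l' hl'
          · exact hlt Cs hCs C hC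
    · by_cases hex : ∃ x ∈ z, l ≤ x
      · obtain ⟨z₁, x, z₂, rfl, hlx, hz₁⟩ := List.exists_eq_append_cons_of_exists hex
        have hx : x ∈ X := hz x (by simp)
        obtain ⟨Cs, hCs, hmem⟩ := hcov z₂ (fun y hy => hz y (by simp [hy]))
          fun h => hnle ((HigmanRel.nil z₁).append (.one hlx h))
        have h1 : Mem (.inr (X.erase l)) z₁ := fun y hy =>
          LowerSet.mem_erase_iff.2 ⟨hz y (by simp [hy]), hz₁ y hy⟩
        by_cases hxi : x ∈ Li
        -- If `x ∈ Li` were above all letters of `l :: w`, it would absorb the whole word.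
        · have h2 : ∃ l' ∈ l :: w, ¬ l' ≤ x := by
            by_contra! H
            exact hnle ((HigmanRel.nil z₁).append
              (by simpa using (HigmanRel.of_forall_le hxi H).append (.nil z₂)))
          obtain ⟨l', hl', hl'x⟩ := h2
          exact ⟨_, .inr (.inr ⟨l', hl', Cs, hCs, rfl⟩), z₁, x :: z₂, rfl, h1, [x], z₂, rfl,
            by simpa [Mem] using LowerSet.mem_erase_iff.2 ⟨hx, hl'x⟩, hmem⟩
        · obtain ⟨J, hJ', hxJ⟩ := hcovJ x ⟨hx, hxi⟩
          exact ⟨_, .inr (.inl ⟨J, hJ', Cs, hCs, rfl⟩), z₁, x :: z₂, rfl, h1, [x], z₂, rfl,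
            .inr ⟨x, hxJ, rfl⟩, hmem⟩
      · push Not at hex
        exact ⟨_, .inl rfl, z, [], by simp,
          fun y hy => LowerSet.mem_erase_iff.2 ⟨hz y hy, hex y hy⟩, rfl⟩

/-- For the first kind, the words over `J` that are not above `[j]` are the empty word and the
letters of `J.erase j`, a finite union of ideals. -/
theorem exists_cover_atom (hLi : IsUpperSet Li) {C : WordAtom L} (hC : Valid Li C) {w : List L}
    (hw : Mem C w) : ∃ 𝒟 : Set (List (WordAtom L)), 𝒟.Finite ∧
      (∀ Cs ∈ 𝒟, ∀ D ∈ Cs, Lt D C ∧ Valid Li D) ∧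
      ∀ z : List L, Mem C z → ¬ HigmanRel Li w z → ∃ Cs ∈ 𝒟, ListMem Cs z := by
  rcases C with J | X
  · rcases hw with rfl | ⟨j, hj, rfl⟩
    · exact ⟨∅, Set.finite_empty, by simp, fun z _ h => (h (.nil z)).elim⟩
    · obtain ⟨𝒥, hfJ, hJ, hcovJ⟩ := LowerSet.exists_finite_ideals (J.erase j)
      refine ⟨{[]} ∪ (fun J' => [.inl J']) '' 𝒥, (Set.finite_singleton _).union (hfJ.image _),
        ?_, ?_⟩
      · rintro _ (rfl | ⟨J', hJ', rfl⟩) D hD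
        · simp at hD
        · rw [List.mem_singleton.1 hD]
          have hlt := (hJ J' hJ').1.trans_lt (LowerSet.erase_lt.2 hj)
          exact ⟨Sum.Lex.inl hlt, (hJ J' hJ').2.1, (hJ J' hJ').2.2,
            fun i hi => hC.2.2 i (hlt.le hi)⟩
      · rintro z (rfl | ⟨i, hi, rfl⟩) hnle
        · exact ⟨[], .inl rfl, rfl⟩
        · obtain ⟨J', hJ', hiJ⟩ := hcovJ i
            (LowerSet.mem_erase_iff.2 ⟨hi, fun hle => hnle (.one hle (.nil _))⟩)
          exact ⟨_, .inr ⟨J', hJ', rfl⟩, [i], [], rfl, .inr ⟨i, hiJ, rfl⟩, rfl⟩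
  · exact exists_cover_star hLi X hw

/-- If `w₁ ++ w₂` is not below `z₁ ++ z₂`, it fails in the first or in the second factor. Refining
that factor trades one atom for finitely many smaller ones, which is a descent in the multiset
order. -/
theorem exists_cover (hLi : IsUpperSet Li) {Cs : List (WordAtom L)} (hC : ∀ C ∈ Cs, Valid Li C)
    {w : List L} (hw : ListMem Cs w) : ∃ 𝒟 : Set (List (WordAtom L)), 𝒟.Finite ∧
      (∀ Ds ∈ 𝒟, Relation.CutExpand Lt (Ds : Multiset (WordAtom L)) Cs ∧ ∀ D ∈ Ds, Valid Li D) ∧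
      ∀ z : List L, ListMem Cs z → ¬ HigmanRel Li w z → ∃ Ds ∈ 𝒟, ListMem Ds z := by
  induction Cs generalizing w with
  | nil =>
    rw [show w = [] from hw]
    exact ⟨∅, Set.finite_empty, by simp, fun z _ h => (h (.nil z)).elim⟩
  | cons C Cs ih =>
    obtain ⟨w₁, w₂, rfl, hw₁, hw₂⟩ := hw
    have hC₁ := hC C List.mem_cons_self
    have hC₂ : ∀ D ∈ Cs, Valid Li D := fun D hD => hC D (List.mem_cons_of_mem _ hD)
    obtain ⟨𝒟₁, hf₁, h₁, hcov₁⟩ := exists_cover_atom hLi hC₁ hw₁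
    obtain ⟨𝒟₂, hf₂, h₂, hcov₂⟩ := ih hC₂ hw₂
    refine ⟨(fun Ds => Ds ++ Cs) '' 𝒟₁ ∪ (fun Ds => C :: Ds) '' 𝒟₂,
      (hf₁.image _).union (hf₂.image _), ?_, ?_⟩
    · rintro _ (⟨Ds, hDs, rfl⟩ | ⟨Ds, hDs, rfl⟩)
      · refine ⟨⟨Ds, C, fun D hD => (h₁ Ds hDs D (Multiset.mem_coe.1 hD)).1, ?_⟩, fun D hD => ?_⟩
        · rw [← Multiset.coe_add, ← Multiset.cons_coe, ← Multiset.singleton_add]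
          abel
        · rcases List.mem_append.1 hD with hD | hD
          · exact (h₁ Ds hDs D hD).2
          · exact hC₂ D hD
      · refine ⟨?_, fun D hD => ?_⟩
        · obtain ⟨t, a, ht, he⟩ := (h₂ Ds hDs).1
          refine ⟨t, a, ht, ?_⟩
          rw [← Multiset.cons_coe, ← Multiset.cons_coe, Multiset.cons_add, he, Multiset.cons_add]
        · rcases List.mem_cons.1 hD with rfl | hD
          · exact hC₁
          · exact (h₂ Ds hDs).2 D hD
    · rintro _ ⟨z₁, z₂, rfl, hz₁, hz₂⟩ hnle
      by_cases h : HigmanRel Li w₁ z₁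
      · obtain ⟨Ds, hDs, hmem⟩ := hcov₂ z₂ hz₂ fun h' => hnle (h.append h')
        exact ⟨_, .inr ⟨Ds, hDs, rfl⟩, z₁, z₂, rfl, hz₁, hmem⟩
      · obtain ⟨Ds, hDs, hmem⟩ := hcov₁ z₁ hz₁ h
        exact ⟨_, .inl ⟨Ds, hDs, rfl⟩, listMem_append hmem hz₂⟩

/-- Every directed set of words is cofinal in a product of atoms. -/
theorem exists_cofinal (hLi : IsUpperSet Li) {Z : Set (List L)} (hne : Z.Nonempty)
    (hdir : ∀ u ∈ Z, ∀ v ∈ Z, ∃ w ∈ Z, HigmanRel Li u w ∧ HigmanRel Li v w) :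
    ∃ Cs : List (WordAtom L), (∀ C ∈ Cs, Valid Li C) ∧ (∀ z ∈ Z, ListMem Cs z) ∧
      ∀ w, ListMem Cs w → ∃ z ∈ Z, HigmanRel Li w z := by
  have hwf : WellFounded fun Cs Ds : List (WordAtom L) =>
      Relation.CutExpand Lt (Cs : Multiset (WordAtom L)) Ds :=
    InvImage.wf _ (WellFounded.cutExpand
      (Sum.lex_wf (wellFounded_lt (α := LowerSet L)) (wellFounded_lt (α := LowerSet L))))
  -- Take a minimal product of atoms that contains `Z`; the set of all words is one candidate.
  obtain ⟨Cs, ⟨hCs, hZ⟩, hmin⟩ := hwf.has_min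
    {Cs | (∀ C ∈ Cs, Valid Li C) ∧ ∀ z ∈ Z, ListMem Cs z} ⟨[.inr ⊤], by simp [Valid],
      fun z _ => ⟨z, [], by simp, fun l _ => trivial, rfl⟩⟩
  refine ⟨Cs, hCs, hZ, fun w hw => ?_⟩
  by_contra! H
  obtain ⟨𝒟, hf, h𝒟, hcov⟩ := exists_cover hLi hCs hw
  -- By minimality each of the finitely many smaller products misses a point of `Z`. As `Z` is
  -- directed and products are downward closed, one point of `Z` is missed by all of them, so they
  -- do not cover `Z`.
  have key : ∀ ℰ : Set (List (WordAtom L)), ℰ.Finite → ℰ ⊆ 𝒟 →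
      ∃ z ∈ Z, ∀ Ds ∈ ℰ, ¬ ListMem Ds z := by
    intro ℰ hℰ
    induction ℰ, hℰ using Set.Finite.induction_on with
    | empty => exact fun _ => hne.imp fun z hz => ⟨hz, by simp⟩
    | @insert Ds ℰ _ _ ih =>
      intro hsub
      obtain ⟨z₁, hz₁, h₁⟩ := ih ((Set.subset_insert _ _).trans hsub)
      have hDs := h𝒟 Ds (hsub (Set.mem_insert _ _))
      have h₂ : ∃ z ∈ Z, ¬ ListMem Ds z := by
        by_contra! h
        exact hmin Ds ⟨hDs.2, h⟩ hDs.1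
      obtain ⟨z₂, hz₂, h₂⟩ := h₂
      obtain ⟨z, hz, hle₁, hle₂⟩ := hdir z₁ hz₁ z₂ hz₂
      refine ⟨z, hz, ?_⟩
      rintro Es (rfl | hEs) hmem
      · exact h₂ (hmem.of_rel hDs.2 hle₂)
      · exact h₁ Es hEs (hmem.of_rel (h𝒟 Es (hsub (Set.mem_insert_of_mem _ hEs))).2 hle₁)
  obtain ⟨z, hz, hno⟩ := key 𝒟 hf subset_rfl
  obtain ⟨Ds, hDs, hmem⟩ := hcov z (hZ z hz) (H z hz)
  exact hno Ds hDs hmem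

end WordAtom

/-! ## Products of letters -/

section Letters

variable {P : Type u} [Preorder P] {α β : Ordinal.{u}}

/-- For a star, `x * (x * c) ≤ x * c ≤ a * b`: if the first copy of `x` is not below `a`, then the
remaining `x * c` is below `b`. -/
theorem mul_le_of_mul_le_mul_of_not_le {x c a b : HSet (FreeMonoid P)} (hx : x ∈ letterSet P α)
    (h : x * c ≤ a * b) (ha : ¬ x ≤ a) : x * c ≤ b := by
  rcases hx with hx | hx
  · exact (isLetterIdeal_of_mem hx).mul_le_of_not_le h ha
  · refine (HSet.le_or_le_of_mul_le_mul (le_trans ?_ h)).resolve_left ha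
    rw [← mul_assoc]
    exact HSet.mul_le_mul_right' c (mul_self_le_of_mem_starIdeals hx)

/-- The product of a word of letters. -/
noncomputable def letterProd (u : List (Letters P α)) : HSet (FreeMonoid P) :=
  (u.map Subtype.val).prod

@[simp] theorem letterProd_nil : letterProd ([] : List (Letters P α)) = 1 := rfl

@[simp] theorem letterProd_cons (x : Letters P α) (u : List (Letters P α)) :
    letterProd (x :: u) = x.1 * letterProd u := by simp [letterProd]

@[simp] theorem letterProd_append (u v : List (Letters P α)) :
    letterProd (u ++ v) = letterProd u * letterProd v := by simp [letterProd]

theorem iterIdeal_letterProd (u : List (Letters P α)) :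
    IterIdeal Set.univ α (letterProd u) := by
  refine Submonoid.list_prod_mem (iterIdealMonoid (FreeMonoid P) α) fun x hx => ?_
  obtain ⟨y, -, rfl⟩ := List.mem_map.1 hx
  exact iterIdeal_of_mem_letterSet y.2

variable (P α) in
/-- The letters of the form `X^*`. -/
abbrev starLetters : Set (Letters P α) := {x | x.1 ∈ starIdeals P α}

variable (P α) in
/-- The letters that are iterated ideals over `P`. -/
abbrev idealLetters : Set (Letters P α) := {x | x.1 ∈ letterIdeals P α}

theorem starLetters_eq_compl : starLetters P α = (idealLetters P α)ᶜ := by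
  ext x
  exact ⟨fun h h' => not_isLetterIdeal_of_mem h (isLetterIdeal_of_mem h'), x.2.resolve_left⟩

theorem isUpperSet_starLetters : IsUpperSet (starLetters P α) := by
  intro x y hxy hx
  refine y.2.resolve_left fun hy => ?_
  exact not_le_of_mem_starIdeals hx (isLetterIdeal_of_mem hy) hxy

theorem isLowerSet_idealLetters : IsLowerSet (idealLetters P α) := by
  rw [← isUpperSet_compl, ← starLetters_eq_compl]
  exact isUpperSet_starLetters

/-! ### The product map preserves and reflects the order -/

theorem letterProd_le_of_rel {u v : List (Letters P α)} (h : HigmanRel (starLetters P α) u v) :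
    letterProd u ≤ letterProd v := by
  induction h with
  | nil v => exact one_le_of_iterIdeal (iterIdeal_letterProd v)
  | skip y h ih =>
    rw [letterProd_cons]
    exact ih.trans (le_mul_of_iterIdeal_left (iterIdeal_of_mem_letterSet y.2))
  | one hxy h ih =>
    rw [letterProd_cons, letterProd_cons]
    exact HSet.mul_le_mul'' hxy ih
  | many hxy hy h ih =>
    rw [letterProd_cons] at ih ⊢
    refine (HSet.mul_le_mul'' hxy ih).trans ?_
    rw [letterProd_cons, ← mul_assoc]
    exact HSet.mul_le_mul_right' _ (mul_self_le_of_mem_starIdeals hy)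

/-- Compare the first letters `x` and `y`. If `x ≰ y`, then `y` is of no use and is skipped. If `x ≤
y`, a star `y` is kept for the remaining letters, and an iterated ideal over `P` is cancelled
together with `x`. -/
theorem rel_of_letterProd_le {u v : List (Letters P α)} (h : letterProd u ≤ letterProd v) :
    HigmanRel (starLetters P α) u v := by
  induction v generalizing u with
  | nil =>
    cases u with
    | nil => exact .nil _
    | cons x u =>
      rw [letterProd_cons, letterProd_nil] at h
      exact (not_le_one_of_mem_letterSet x.2
        ((IterIdeal.le_mul (iterIdeal_letterProd u) _).trans h)).elim
  | cons y v ihv =>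
    induction u with
    | nil => exact .nil _
    | cons x u ihu =>
      rw [letterProd_cons, letterProd_cons] at h
      by_cases hxy : x ≤ y
      · by_cases hy : y.1 ∈ starIdeals P α
        · refine .many hxy hy (ihu ?_)
          rw [letterProd_cons]
          exact (le_mul_of_iterIdeal_left (iterIdeal_of_mem_letterSet x.2)).trans h
        · exact .one hxy (ihv ((isLetterIdeal_of_mem (y.2.resolve_right hy)).le_of_mul_le_mul h
            (not_le_one_of_mem_letterSet x.2)))
      · refine .skip y (ihv ?_)
        rw [letterProd_cons]
        exact mul_le_of_mul_le_mul_of_not_le x.2 h hxy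

/-! ### Surjectivity of the product map up to equivalence -/

theorem exists_letterProd_eq_ur (q : FreeMonoid P) :
    ∃ u : List (Letters P α), letterProd u = HSet.ur q := by
  induction q using FreeMonoid.inductionOn' with
  | one => exact ⟨[], rfl⟩
  | of_mul p q ih =>
    obtain ⟨u, hu⟩ := ih
    exact ⟨⟨_, .inl (ur_mem_letterIdeals p)⟩ :: u, by
      rw [letterProd_cons, hu, HSet.ur_mul_ur]⟩

theorem mem_closure_image_val_iff {X : Set (Letters P α)} {z : HSet (FreeMonoid P)} :
    z ∈ Submonoid.closure (Subtype.val '' X) ↔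
      ∃ w : List (Letters P α), (∀ l ∈ w, l ∈ X) ∧ z = letterProd w := by
  constructor
  · intro hz
    induction hz using Submonoid.closure_induction with
    | mem z hz =>
      obtain ⟨x, hx, rfl⟩ := hz
      exact ⟨[x], by simpa using hx, by simp⟩
    | one => exact ⟨[], by simp, rfl⟩
    | mul _ _ _ _ ih₁ ih₂ =>
      obtain ⟨w₁, h₁, rfl⟩ := ih₁
      obtain ⟨w₂, h₂, rfl⟩ := ih₂
      refine ⟨w₁ ++ w₂, fun l hl => ?_, by simp⟩
      exact (List.mem_append.1 hl).elim (h₁ l) (h₂ l)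
  · rintro ⟨w, hw, rfl⟩
    refine Submonoid.list_prod_mem _ fun x hx => ?_
    obtain ⟨y, hy, rfl⟩ := List.mem_map.1 hx
    exact Submonoid.subset_closure ⟨y, hw y hy, rfl⟩

/-- An ideal `J` becomes the set of its letters, which is an iterated ideal over `P` because
validity excludes stars; a non-empty `X` becomes the letter `X^*`. -/
theorem exists_word_of_atom (hβ : β < α) {C : WordAtom (Letters P β)}
    (hC : C.Valid (starLetters P β)) : ∃ u : List (Letters P α),
      (∀ w, C.Mem w → ∃ e ∈ (letterProd u).els, letterProd w ≤ e) ∧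
      ∀ e ∈ (letterProd u).els, ∃ w, C.Mem w ∧ e = letterProd w := by
  have hsmall := IterIdeal.small (Set.univ : Set (FreeMonoid P)) β
  rcases C with J | X
  · obtain ⟨⟨j₀, hj₀⟩, hdir, hJ⟩ := hC
    have : Small.{u} (Subtype.val '' (J : Set (Letters P β))) := by
      refine small_subset (s := {x : HSet (FreeMonoid P) | IterIdeal Set.univ β x}) ?_
      rintro _ ⟨x, -, rfl⟩
      exact iterIdeal_of_mem_letterSet x.2
    obtain ⟨z, hz, hmem⟩ := HSet.exists_isSet_mem_iff (Subtype.val '' (J : Set (Letters P β)))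
    have hzI : z ∈ letterIdeals P α := by
      refine IterIdeal.set hβ hz ⟨j₀.1, (hmem _).2 ⟨j₀, hj₀, rfl⟩⟩ ?_ ?_
      · intro y hy
        obtain ⟨j, hj, rfl⟩ := (hmem y).1 hy
        exact j.2.resolve_right (hJ j hj)
      · intro y hy y' hy'
        obtain ⟨i, hi, rfl⟩ := (hmem y).1 hy
        obtain ⟨j, hj, rfl⟩ := (hmem y').1 hy'
        obtain ⟨k, hk, hik, hjk⟩ := hdir i hi j hj
        exact ⟨k.1, (hmem _).2 ⟨k, hk, rfl⟩, hik, hjk⟩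
    refine ⟨[⟨z, .inl hzI⟩], ?_, ?_⟩ <;>
    simp only [letterProd_cons, letterProd_nil, mul_one, HSet.mem_els_of_isSet hz, hmem]
    · rintro w (rfl | ⟨j, hj, rfl⟩)
      -- The empty word belongs to the atom but `1` need not be an element of the set, which is why
      -- words are only required to lie below elements.
      · exact ⟨j₀.1, ⟨j₀, hj₀, rfl⟩, one_le_of_iterIdeal (iterIdeal_of_mem_letterSet j₀.2)⟩
      · exact ⟨j.1, ⟨j, hj, rfl⟩, by simp⟩
    · rintro _ ⟨j, hj, rfl⟩
      exact ⟨[j], .inr ⟨j, hj, rfl⟩, by simp⟩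
  · by_cases hne : (X : Set (Letters P β)).Nonempty
    · have : Small.{u} (Submonoid.closure (Subtype.val '' (X : Set (Letters P β))) :
          Set (HSet (FreeMonoid P))) := by
        refine small_subset (s := {x : HSet (FreeMonoid P) | IterIdeal Set.univ β x}) ?_
        intro z hz
        obtain ⟨w, -, rfl⟩ := mem_closure_image_val_iff.1 hz
        exact iterIdeal_letterProd w
      obtain ⟨z, hz, hmem⟩ := HSet.exists_isSet_mem_iff
        (Submonoid.closure (Subtype.val '' (X : Set (Letters P β))) : Set (HSet (FreeMonoid P)))
      have hzS : z ∈ starIdeals P α := by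
        refine mem_starIdeals.2 ⟨β, hβ, Subtype.val '' (X : Set (Letters P β)),
          ⟨hne.image _, ?_, ?_⟩, hz, hmem⟩
        · rintro _ ⟨x, -, rfl⟩
          exact x.2
        · rintro _ ⟨x, hx, rfl⟩ b hb hbx
          exact ⟨⟨b, hb⟩, X.lower (show (⟨b, hb⟩ : Letters P β) ≤ x from hbx) hx, rfl⟩
      refine ⟨[⟨z, .inr hzS⟩], ?_, ?_⟩ <;>
      simp only [letterProd_cons, letterProd_nil, mul_one, HSet.mem_els_of_isSet hz, hmem,
        SetLike.mem_coe, mem_closure_image_val_iff]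
      · exact fun w hw => ⟨_, ⟨w, hw, rfl⟩, le_rfl⟩
      · exact fun e he => he
    -- The star of the empty set is not a letter; the empty word represents this factor.
    · have hX : ∀ w, WordAtom.Mem (.inr X) w ↔ w = [] := fun w =>
        ⟨fun hw => List.eq_nil_iff_forall_not_mem.2 fun l hl => hne ⟨l, hw l hl⟩, by
          rintro rfl
          simp [WordAtom.Mem]⟩
      refine ⟨[], ?_, ?_⟩ <;> simp [hX]

theorem exists_word_of_atoms (hβ : β < α) {Cs : List (WordAtom (Letters P β))}
    (hCs : ∀ C ∈ Cs, C.Valid (starLetters P β)) : ∃ u : List (Letters P α),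
      (∀ w, WordAtom.ListMem Cs w → ∃ e ∈ (letterProd u).els, letterProd w ≤ e) ∧
      ∀ e ∈ (letterProd u).els, ∃ w, WordAtom.ListMem Cs w ∧ e = letterProd w := by
  induction Cs with
  | nil =>
    refine ⟨[], ?_, ?_⟩ <;> simp [WordAtom.ListMem]
  | cons C Cs ih =>
    obtain ⟨u₁, h₁, h₁'⟩ := exists_word_of_atom hβ (hCs C List.mem_cons_self)
    obtain ⟨u₂, h₂, h₂'⟩ := ih fun D hD => hCs D (List.mem_cons_of_mem _ hD)
    refine ⟨u₁ ++ u₂, ?_, ?_⟩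
    · rintro _ ⟨w₁, w₂, rfl, hw₁, hw₂⟩
      obtain ⟨e₁, he₁, hle₁⟩ := h₁ w₁ hw₁
      obtain ⟨e₂, he₂, hle₂⟩ := h₂ w₂ hw₂
      rw [letterProd_append, letterProd_append]
      exact ⟨e₁ * e₂, HSet.mul_mem_els he₁ he₂, HSet.mul_le_mul'' hle₁ hle₂⟩
    · rw [letterProd_append, HSet.els_mul]
      rintro _ ⟨e₁, he₁, e₂, he₂, rfl⟩
      obtain ⟨w₁, hw₁, rfl⟩ := h₁' e₁ he₁
      obtain ⟨w₂, hw₂, rfl⟩ := h₂' e₂ he₂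
      exact ⟨w₁ ++ w₂, ⟨w₁, w₂, rfl, hw₁, hw₂⟩, (letterProd_append w₁ w₂).symm⟩

theorem IsOrdinalWqo.mono {ζ ξ : Ordinal.{v}} (h : IsOrdinalWqo P ζ) (hξ : ξ ≤ ζ) :
    IsOrdinalWqo P ξ :=
  ⟨h.1, fun F hF => h.2 F (hF.trans_le hξ)⟩

/-- Every iterated ideal over the words is equivalent to a product of letters. -/
theorem exists_letterProd_equiv (hP : IsOrdinalWqo P (α + 1)) {z : HSet (FreeMonoid P)}
    (hz : IterIdeal Set.univ α z) :
    ∃ u : List (Letters P α), letterProd u ≤ z ∧ z ≤ letterProd u := by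
  induction α using WellFoundedLT.induction generalizing z with
  | ind α ih =>
    rcases HSet.isSet_or_ur z with hset | ⟨q, rfl⟩
    · obtain ⟨β, hβ, hmem⟩ := hz.exists_lt_of_isSet hset
      have hPβ : IsOrdinalWqo P (β + 1) := hP.mono (by gcongr)
      have := (wellQuasiOrdered_letters hPβ).wellFoundedLT_lowerSet
      have hrep : ∀ z' ∈ z.els, ∃ u : List (Letters P β), letterProd u ≤ z' ∧ z' ≤ letterProd u :=
        fun z' hz' => ih β hβ hPβ (hmem z' ((HSet.mem_els_of_isSet hset).1 hz'))
      -- Let `Z` be the set of all words that represent elements of `z`. It is directed because `z`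
      -- is and because the product map reflects the order.
      obtain ⟨Cs, hCs, hZ, hcof⟩ := WordAtom.exists_cofinal (isUpperSet_starLetters (α := β))
        (Z := {u | ∃ z' ∈ z.els, letterProd u ≤ z' ∧ z' ≤ letterProd u}) (by
          obtain ⟨z', hz'⟩ := hz.els_nonempty
          exact (hrep z' hz').imp fun u hu => ⟨z', hz', hu⟩) (by
          rintro u ⟨x, hx, hux, -⟩ v ⟨y, hy, hvy, -⟩
          obtain ⟨z', hz', hxz, hyz⟩ := hz.els_directed hx hy
          obtain ⟨w, hw, hw'⟩ := hrep z' hz'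
          exact ⟨w, ⟨z', hz', hw, hw'⟩, rel_of_letterProd_le (hux.trans (hxz.trans hw')),
            rel_of_letterProd_le (hvy.trans (hyz.trans hw'))⟩)
      obtain ⟨u, hu, hu'⟩ := exists_word_of_atoms hβ hCs
      refine ⟨u, ?_, ?_⟩ <;> rw [HSet.le_iff_els]
      · intro e he
        obtain ⟨w, hw, rfl⟩ := hu' e he
        obtain ⟨v, ⟨z', hz', hv, -⟩, hwv⟩ := hcof w hw
        exact ⟨z', hz', (letterProd_le_of_rel hwv).trans hv⟩
      · intro z' hz'
        obtain ⟨w, hw, hw'⟩ := hrep z' hz'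
        obtain ⟨e, he, hle⟩ := hu w (hZ w ⟨z', hz', hw, hw'⟩)
        exact ⟨e, he, hw'.trans hle⟩
    · obtain ⟨u, hu⟩ := exists_letterProd_eq_ur (α := α) q
      exact ⟨u, hu.le, hu.ge⟩

variable (P α) in
/-- The product map from words of letters to iterated ideals. -/
noncomputable def letterProdHom : GenHigman (idealLetters P α) (starLetters P α)
    isLowerSet_idealLetters starLetters_eq_compl →* iterIdealMonoid (FreeMonoid P) α where
  toFun u := ⟨letterProd (FreeMonoid.toList u), iterIdeal_letterProd _⟩
  map_one' := rfl
  map_mul' u v := Subtype.ext (letterProd_append (FreeMonoid.toList u) (FreeMonoid.toList v))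

theorem letterProdHom_le_iff {u v : GenHigman (idealLetters P α) (starLetters P α)
    isLowerSet_idealLetters starLetters_eq_compl} :
    letterProdHom P α u ≤ letterProdHom P α v ↔ u ≤ v :=
  ⟨fun h => GenHigman.Le.of_rel (rel_of_letterProd_le h), fun h =>
    letterProd_le_of_rel (GenHigman.Le.rel h)⟩

theorem exists_letterProdHom_equiv (hP : IsOrdinalWqo P (α + 1))
    (z : iterIdealMonoid (FreeMonoid P) α) :
    ∃ u, letterProdHom P α u ≤ z ∧ z ≤ letterProdHom P α u := by
  obtain ⟨u, hu⟩ := exists_letterProd_equiv hP z.2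
  exact ⟨FreeMonoid.ofList u, hu⟩

end Letters

/-! ## Quotients -/

/-- A homomorphism of monoidal quasi-orders that reflects the order and is surjective up to
equivalence induces an isomorphism of the quotients. -/
theorem QoQuot.nonempty_orderMonoidIso {M : Type u} {N : Type v} [Monoid M] [Preorder M]
    [IsMonoidalQo M] [Monoid N] [Preorder N] [IsMonoidalQo N] (φ : N →* M)
    (hle : ∀ {a b}, φ a ≤ φ b ↔ a ≤ b) (hsurj : ∀ m, ∃ n, φ n ≤ m ∧ m ≤ φ n) :
    Nonempty (QoQuot M ≃*o QoQuot N) := by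
  let ψ : QoQuot N →* QoQuot M :=
    { toFun := Quotient.map φ fun a b h => ⟨hle.2 h.1, hle.2 h.2⟩
      map_one' := congrArg (toAntisymmetrization (α := M) (· ≤ ·)) φ.map_one
      map_mul' := by
        rintro ⟨a⟩ ⟨b⟩
        exact congrArg (toAntisymmetrization (α := M) (· ≤ ·)) (φ.map_mul a b) }
  have hψ : ∀ a b, ψ a ≤ ψ b ↔ a ≤ b := by
    rintro ⟨a⟩ ⟨b⟩
    exact hle
  have hbij : Function.Bijective ψ := by
    refine ⟨fun a b h => le_antisymm ((hψ a b).1 h.le) ((hψ b a).1 h.ge), ?_⟩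
    rintro ⟨m⟩
    obtain ⟨n, hn⟩ := hsurj m
    exact ⟨toAntisymmetrization (· ≤ ·) n, Quotient.sound hn⟩
  let e := MulEquiv.ofBijective ψ hbij
  refine ⟨⟨e.symm, fun {a b} => ?_⟩⟩
  change e.symm a ≤ e.symm b ↔ a ≤ b
  rw [← hψ, show ψ (e.symm a) = a from e.apply_symm_apply a,
    show ψ (e.symm b) = b from e.apply_symm_apply b]

/-- Higman's lemma for the generalized Higman ordering. -/
theorem GenHigman.wellQuasiOrdered {L : Type u} [Preorder L] {Ln Li : Set L} {hn : IsLowerSet Ln}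
    {hi : Li = Lnᶜ} (h : WellQuasiOrdered fun x y : L => x ≤ y) :
    WellQuasiOrdered fun x y : GenHigman Ln Li hn hi => x ≤ y := by
  intro f
  obtain ⟨m, n, hmn, hle⟩ := (Set.PartiallyWellOrderedOn.partiallyWellOrderedOn_sublistForall₂ _
    (Set.partiallyWellOrderedOn_of_wellQuasiOrdered h Set.univ)).exists_lt
    (f := fun n => FreeMonoid.toList (f n)) fun n x _ => Set.mem_univ x
  exact ⟨m, n, hmn, GenHigman.Le.of_sublistForall₂ hle⟩

theorem QoQuot.wellQuasiOrderedLE {M : Type u} {N : Type v} [Preorder M] [Preorder N] (φ : N → M)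
    (hle : ∀ {a b}, a ≤ b → φ a ≤ φ b) (hsurj : ∀ m, ∃ n, φ n ≤ m ∧ m ≤ φ n)
    (hN : WellQuasiOrdered fun a b : N => a ≤ b) : WellQuasiOrderedLE (QoQuot M) := by
  refine ⟨fun f => ?_⟩
  choose g hg using fun n => hsurj (ofAntisymmetrization (· ≤ ·) (f n))
  obtain ⟨m, n, hmn, h⟩ := hN g
  refine ⟨m, n, hmn, ?_⟩
  exact ofAntisymmetrization_le_ofAntisymmetrization_iff.1 <| (hg m).2.trans ((hle h).trans (hg n).1)

theorem mainTheorem10 {P : Type u} [Preorder P] (α : Ordinal.{u})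
    (hP : IsOrdinalWqo P (α + 1)) :
    IsMonoidalWqo (QoQuot (iterIdealMonoid (FreeMonoid P) α)) ∧
    ∃ (hn : IsLowerSet {x : Letters P α | x.1 ∈ letterIdeals P α})
      (hi : {x : Letters P α | x.1 ∈ starIdeals P α} =
        {x : Letters P α | x.1 ∈ letterIdeals P α}ᶜ),
      Nonempty (QoQuot (iterIdealMonoid (FreeMonoid P) α) ≃*o
        QoQuot (GenHigman {x : Letters P α | x.1 ∈ letterIdeals P α}
          {x : Letters P α | x.1 ∈ starIdeals P α} hn hi)) := by
  have := QoQuot.wellQuasiOrderedLE (letterProdHom P α) letterProdHom_le_iff.2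
    (exists_letterProdHom_equiv hP) (GenHigman.wellQuasiOrdered (wellQuasiOrdered_letters hP))
  exact ⟨{ }, isLowerSet_idealLetters, starLetters_eq_compl,
    QoQuot.nonempty_orderMonoidIso (letterProdHom P α) letterProdHom_le_iff
      (exists_letterProdHom_equiv hP)⟩
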